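/- Let $\Gamma$ be a metric graph (a compact connected length metric space that is locally a finite star) and let $D$ be a divisor on $\Gamma$. Let $\mathrm{PL}(\Gamma)$ be the set of continuous piecewise linear functions $\Gamma\to\mathbb R$ with integer slopes. For a tangent vector $\zeta$ write $s_\zeta(\varphi)$ for the outgoing slope of $\varphi$ along $\zeta$. Put $\operatorname{ord}_v(\varphi)=-\sum_{\zeta\in T_v\Gamma}s_\zeta(\varphi)$, $\operatorname{div}\varphi=\sum_v\operatorname{ord}_v(\varphi)\,v$ and $R(D)=\{\varphi\in\mathrm{PL}(\Gamma):\operatorname{div}\varphi+D\ge 0\}$. A family of functions with coefficients in $\mathbb R\cup\{\infty\}$ is a *tropical dependence* if, at every point of $\Gamma$, the minimum of the functions plus their coefficients is attained at least twice. A *tropical linear series of rank $r$* is a subset $\Sigma\subseteq R(D)$, closed under tropical linear combinations $\min_i\{\varphi_i+a_i\}$ ($a_i\in\mathbb R$), such that 1. for every effective divisor $E$ of degree $r$ there is $\varphi\in\Sigma$ with $\operatorname{div}\varphi+D\ge E$; 2. every set of $r+2$ functions in $\Sigma$ is tropically dependent (with real coefficients); 3. for every tangent vector $\zeta$ and $0\le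 i<r$, the set $\{\varphi\in\Sigma: s_\zeta(\varphi)\le s_\zeta[i]\}$ contains a tropical linear series of rank $i$ in $R(D)$, where $s_\zeta[0]<s_\zeta[1]<\cdots$ are the slopes along $\zeta$ of the functions in $\Sigma$. It is *strong* if moreover 4. $|\Sigma|=\{D+\operatorname{div}\varphi:\varphi\in\Sigma\}$ is closed in $|D|=|R(D)|\subseteq\operatorname{Sym}^{\deg D}\Gamma$ and is definable (in the coordinates of each cell of $|D|$, a Boolean combination of half-spaces with integer normal vectors); 5. there is a valuated matroid $\mathcal V$ of rank $r+1$ on $\Sigma$ such that, for each valuated circuit $V\in\mathcal V$, $\min_{\varphi\in\Sigma}\{\varphi+V(\varphi)\}$ is a tropical dependence. Let $\Sigma=\langle\varphi_0,\dots,\varphi_n\rangle$ be a finitely generated strong tropical linear series of rank $r$. Then for every $\mathcal V$ as in (5), the restriction of $\mathcal V$ to $\varphi_0,\dots,\varphi_n$ (its circuits supported on the generators) is a valuated matroid $M$ on $\{0,\dots,n\}$ such that $(*)$ for each valuated circuit $V$ of $M$, $\min_i\{\varphi_i+V(i)\}$ is a tropical dependence. Let $M$ be any valuated matroid on $\{0,\dots,n\}$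 satisfying $(*)$, and let $\mathbb{TP}^n=\mathbb R^{n+1}/\mathbb R(1,\dots,1)$ and $$\mathcal B(M)=\{x\in\mathbb{TP}^n:\ \min_i\{V(i)+x_i\}\text{ is attained at least twice for all valuated circuits }V\text{ of }M\}.$$ Then the map $\Phi=[\varphi_0:\dots:\varphi_n]:\Gamma\to\mathbb{TP}^n$ has image in $\mathcal B(M)$, and there exist a tropical modification $\widetilde\Gamma\supseteq\Gamma$ and a balanced map $\widetilde\Phi:\widetilde\Gamma\to\mathcal B(M)$ with $\widetilde\Phi|_\Gamma=\Phi$. Here a *tropical modification* of $\Gamma$ is a metric space obtained from $\Gamma$ by finitely many successive steps, each attaching one infinite ray $[0,\infty)$ at a point of the space constructed so far. A map $\widetilde\Phi:\widetilde\Gamma\to\mathbb{TP}^n$ is *balanced* if it is continuous and piecewise linear with outgoing slopes in $\mathbb Z^{n+1}/\mathbb Z(1,\dots,1)$, and at every point of $\widetilde\Gamma$ the sum of the outgoing slopes over all tangent vectors is $0$. -/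

import Mathlib

open Set Filter Topology

universe u

namespace TropicalSeries

/-! ### Metric graphs, tangent vectors and slopes -/

/-- A metric graph: a compact connected length space (for compact spaces this is the same as a
geodesic space) in which every point has a ball isometric to a star with finitely many arms. -/
structure IsMetricGraph (X : Type u) [MetricSpace X] : Prop where
  compact : CompactSpace X
  connected : ConnectedSpace X
  geodesic : ∀ x y : X, ∃ γ : ℝ → X, γ 0 = x ∧ γ (dist x y) = y ∧
    ∀ s ∈ Icc 0 (dist x y), ∀ t ∈ Icc 0 (dist x y), dist (γ s) (γ t) = |s - t|
  star : ∀ v : X, ∃ (k : ℕ) (ε : ℝ) (arm : Fin k → ℝ → X), 0 < ε ∧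
    (∀ i, arm i 0 = v) ∧
    (∀ i, ∀ s ∈ Ico 0 ε, ∀ t ∈ Ico 0 ε, dist (arm i s) (arm i t) = |s - t|) ∧
    (∀ i j, i ≠ j → ∀ s ∈ Ico 0 ε, ∀ t ∈ Ico 0 ε, dist (arm i s) (arm j t) = s + t) ∧
    ∀ y, dist y v < ε → y = v ∨ ∃ i, ∃ t ∈ Ico 0 ε, y = arm i t

/-- A unit speed geodesic segment starting at `v` (only its values near `0` in `[0, ∞)` matter). -/
def Segment {X : Type u} [MetricSpace X] (v : X) : Type u :=
  {γ : ℝ → X // γ 0 = v ∧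
    ∃ ε > 0, ∀ s ∈ Icc 0 ε, ∀ t ∈ Icc 0 ε, dist (γ s) (γ t) = |s - t|}

/-- Two segments at `v` define the same tangent vector when they agree near `v`. -/
instance segmentSetoid {X : Type u} [MetricSpace X] (v : X) : Setoid (Segment v) where
  r γ δ := ∀ᶠ t in 𝓝[≥] (0 : ℝ), γ.1 t = δ.1 t
  iseqv :=
    { refl := fun _ => Eventually.of_forall fun _ => rfl
      symm := fun h => h.mono fun _ ht => ht.symm
      trans := fun h h' => (h.and h').mono fun _ ht => ht.1.trans ht.2 }

/-- The set `T_v(X)` of tangent vectors based at `v`. -/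
def TangentVector {X : Type u} [MetricSpace X] (v : X) : Type u :=
  Quotient (segmentSetoid v)

/-- Along the tangent vector `ζ` at `v`, the map `f` is affine near `v` with outgoing slope `s`. -/
def HasSlope {X : Type u} [MetricSpace X] {W : Type*} [AddCommGroup W] [Module ℝ W]
    (f : X → W) {v : X} (ζ : TangentVector v) (s : W) : Prop :=
  ∃ γ : Segment v, Quotient.mk (segmentSetoid v) γ = ζ ∧
    ∀ᶠ t in 𝓝[≥] (0 : ℝ), f (γ.1 t) = f v + t • s

open Classical in
/-- The outgoing slope `s_ζ(f)` (`0` if `f` is not affine along `ζ`). -/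
noncomputable def outSlope {X : Type u} [MetricSpace X] {W : Type*} [AddCommGroup W] [Module ℝ W]
    (f : X → W) {v : X} (ζ : TangentVector v) : W :=
  if h : ∃ s, HasSlope f ζ s then h.choose else 0

/-! ### Piecewise linear functions and divisors -/

/-- `PL(X)`: continuous piecewise linear functions with integer slopes. -/
def PL (X : Type u) [MetricSpace X] : Set (X → ℝ) :=
  {f | Continuous f ∧ ∀ (v : X) (ζ : TangentVector v), ∃ z : ℤ, HasSlope f ζ (z : ℝ)}

/-- `ord_v(f)`: minus the sum of the outgoing slopes of `f` at `v`. -/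
noncomputable def ord {X : Type u} [MetricSpace X] (f : X → ℝ) (v : X) : ℝ :=
  -∑ᶠ ζ : TangentVector v, outSlope f ζ

/-- The degree of a divisor. -/
def degree {X : Type u} (D : X →₀ ℤ) : ℤ := D.sum fun _ c => c

/-- `R(D)`: the functions `f` in `PL(X)` such that `D + div f` is effective. -/
def R {X : Type u} [MetricSpace X] (D : X →₀ ℤ) : Set (X → ℝ) :=
  {f | f ∈ PL X ∧ ∀ v, 0 ≤ ord f v + D v}

/-! ### Tropical modules and dependence -/

/-- The minimum of the family `g` exists and is attained at least twice. -/
def MinTwice {ι α : Type*} [LE α] (g : ι → α) : Prop :=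
  ∃ i j, i ≠ j ∧ g i = g j ∧ ∀ k, g i ≤ g k

/-- The set of all tropical linear combinations of elements of `S`. -/
def tropicalSpan {X : Type u} (S : Set (X → ℝ)) : Set (X → ℝ) :=
  {θ | ∃ (T : Finset (X → ℝ)) (hT : T.Nonempty), (T : Set (X → ℝ)) ⊆ S ∧
    ∃ a : (X → ℝ) → ℝ, θ = fun x => T.inf' hT fun f => f x + a f}

/-- A tropical submodule: a set closed under all tropical linear combinations. -/
def IsTropicalSubmodule {X : Type u} (S : Set (X → ℝ)) : Prop :=
  tropicalSpan S ⊆ S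

/-- A finite set of functions is tropically dependent. -/
def IsTropicallyDependent {X : Type u} (T : Finset (X → ℝ)) : Prop :=
  ∃ a : T → ℝ, ∀ x, MinTwice fun f : T => f.1 x + a f

/-! ### Tropical linear series -/

/-- The set of outgoing slopes along `ζ` of the functions in `S`. -/
def slopeSet {X : Type u} [MetricSpace X] (S : Set (X → ℝ)) {v : X} (ζ : TangentVector v) :
    Set ℝ :=
  {s | ∃ f ∈ S, outSlope f ζ = s}

/-- `s` is the entry `s_ζ[i]` of the increasing vector of slopes of `S` along `ζ`. -/
def IsSlopeEntry {X : Type u} [MetricSpace X] (S : Set (X → ℝ)) {v : X} (ζ : TangentVector v)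
    (i : ℕ) (s : ℝ) : Prop :=
  s ∈ slopeSet S ζ ∧ {s' ∈ slopeSet S ζ | s' < s}.encard = i

/-- `S ⊆ R(D)` is a tropical linear series of rank `r`. -/
def IsTropicalLinearSeries {X : Type u} [MetricSpace X] (D : X →₀ ℤ) (r : ℕ)
    (S : Set (X → ℝ)) : Prop :=
  S ⊆ R D ∧ IsTropicalSubmodule S ∧
  (∀ E : X →₀ ℤ, 0 ≤ E → degree E = r → ∃ f ∈ S, ∀ v, (E v : ℝ) ≤ ord f v + D v) ∧
  (∀ T : Finset (X → ℝ), (T : Set (X → ℝ)) ⊆ S → T.card = r + 2 → IsTropicallyDependent T) ∧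
  ∀ (v : X) (ζ : TangentVector v) (i : ℕ) (_ : i < r) (s : ℝ), IsSlopeEntry S ζ i s →
    ∃ S' ⊆ {f ∈ S | outSlope f ζ ≤ s}, IsTropicalLinearSeries D i S'
termination_by r

/-! ### Valuated matroids -/

/-- The support of a function with values in `ℝ ∪ {∞}`. -/
def supp {E : Type*} (V : E → WithTop ℝ) : Set E := {e | V e ≠ ⊤}

/-- A subset of the ground set containing the support of no valuated circuit. -/
def IsIndependent {E : Type*} (C : Set (E → WithTop ℝ)) (A : Set E) : Prop :=
  ∀ V ∈ C, ¬ supp V ⊆ A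

/-- `C` is the set of valuated circuits of a valuated matroid of rank `k` on `E`. -/
structure IsValuatedMatroid {E : Type*} (C : Set (E → WithTop ℝ)) (k : ℕ) : Prop where
  infty_notMem : (fun _ => ⊤) ∉ C
  add_const : ∀ V ∈ C, ∀ a : ℝ, (fun e => V e + (a : WithTop ℝ)) ∈ C
  incomparable : ∀ V ∈ C, ∀ W ∈ C, supp V ≠ supp W → ¬ supp V ⊆ supp W
  rank_attained : ∃ A : Set E, IsIndependent C A ∧ A.encard = k
  rank_le : ∀ A : Set E, IsIndependent C A → A.encard ≤ k
  elimination : ∀ V ∈ C, ∀ W ∈ C, ∀ e e' : E, V e = W e → V e ≠ ⊤ → V e' < W e' →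
    ∃ U ∈ C, U e = ⊤ ∧ U e' = V e' ∧ ∀ x, min (V x) (W x) ≤ U x

/-- The tropical linear combination `min_e {φ_e + V(e)}` is a tropical dependence. -/
def IsDependence {X : Type u} {E : Type*} (φ : E → X → ℝ) (V : E → WithTop ℝ) : Prop :=
  ∀ x, MinTwice fun e => (φ e x : WithTop ℝ) + V e

/-- The restriction of a valuated matroid on the set `S` of functions to a family `φ` of elements
of `S`: the circuits with support in the family. -/
def restrictCircuits {X : Type u} {S : Set (X → ℝ)} (C : Set (S → WithTop ℝ)) {E : Type*} (φ : E → S) :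
    Set (E → WithTop ℝ) :=
  {W | ∃ V ∈ C, supp V ⊆ range φ ∧ W = fun e => V (φ e)}

/-! ### Closed and definable sets of divisors -/

/-- The preimage in `X^d` of `{D + div f | f ∈ S} ⊆ Sym^d X`. -/
def divisorTuples {X : Type u} [MetricSpace X] (D : X →₀ ℤ) (S : Set (X → ℝ)) (d : ℕ) :
    Set (Fin d → X) :=
  {p | ∃ f ∈ S, ∀ x, ord f x + D x = ({i | p i = x}.ncard : ℝ)}

/-- `|S|` is closed in `|D|`, for the topology of `Sym^d X = X^d / 𝔖_d` with `d = deg D`. -/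
def IsClosedSeries {X : Type u} [MetricSpace X] (D : X →₀ ℤ) (S : Set (X → ℝ)) : Prop :=
  ∀ d : ℕ, (d : ℤ) = degree D →
    ∃ K : Set (Fin d → X), IsClosed K ∧ divisorTuples D S d = K ∩ divisorTuples D (R D) d

/-- Definable subsets of `ℝ^k`: Boolean combinations of halfspaces with integral normal vector. -/
inductive IsDefinable {k : ℕ} : Set (Fin k → ℝ) → Prop
  | halfspace (v : Fin k → ℤ) (a : ℝ) : IsDefinable {u | a ≤ ∑ i, u i * (v i : ℝ)}
  | compl (A : Set (Fin k → ℝ)) : IsDefinable A → IsDefinable Aᶜ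
  | inter (A B : Set (Fin k → ℝ)) : IsDefinable A → IsDefinable B → IsDefinable (A ∩ B)

/-- A model of `X`, with an orientation of each edge: a finite set of vertices and finitely many
edges, parametrized by arc length, whose interiors partition the complement of the vertices. -/
structure Model (X : Type u) [MetricSpace X] where
  vert : Set X
  vert_finite : vert.Finite
  Edge : Type
  edge_finite : Finite Edge
  len : Edge → ℝ
  len_pos : ∀ e, 0 < len e
  param : Edge → ℝ → X
  param_isometry : ∀ e, ∃ δ > 0, ∀ s ∈ Icc 0 (len e), ∀ t ∈ Icc 0 (len e), |s - t| < δ →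
    dist (param e s) (param e t) = |s - t|
  start_mem : ∀ e, param e 0 ∈ vert
  end_mem : ∀ e, param e (len e) ∈ vert
  interior_notMem : ∀ e, ∀ t ∈ Ioo 0 (len e), param e t ∉ vert
  injective : ∀ e e', ∀ t ∈ Ioo 0 (len e), ∀ t' ∈ Ioo 0 (len e'),
    param e t = param e' t' → e = e' ∧ t = t'
  cover : ∀ x, x ∉ vert → ∃ e, ∃ t ∈ Ioo 0 (len e), param e t = x

open Classical in
/-- The part of `|S|` in a cell of `|D|`, in the coordinates of the cell.  The cell is given by the
multiplicities `c` at the vertices, the edges `σ i` containing the points of the divisor in the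
interiors of edges, their multiplicities `w i`, and the starting slopes `m` along the edges.  The
coordinates are the positions `u i` of the points on their edges. -/
noncomputable def cellCoordinates {X : Type u} [MetricSpace X] (G : Model X) (D : X →₀ ℤ)
    (S : Set (X → ℝ)) {k : ℕ} (c : X → ℤ) (σ : Fin k → G.Edge) (w : Fin k → ℤ)
    (m : G.Edge → ℤ) : Set (Fin k → ℝ) :=
  {u | (∀ i, u i ∈ Ioo 0 (G.len (σ i))) ∧ (∀ i j, i < j → σ i = σ j → u i < u j) ∧
    ∃ f ∈ S, (∀ v ∈ G.vert, ord f v + D v = c v) ∧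
      (∀ e, ∀ t ∈ Ioo 0 (G.len e), ord f (G.param e t) + D (G.param e t) =
        ∑ i, if σ i = e ∧ u i = t then (w i : ℝ) else 0) ∧
      ∀ e, ∀ᶠ t in 𝓝[≥] (0 : ℝ), f (G.param e t) = f (G.param e 0) + t * m e}

/-- `|S|` is a definable subset of `|D|`: its part in each cell is definable. -/
def IsDefinableSeries {X : Type u} [MetricSpace X] (D : X →₀ ℤ) (S : Set (X → ℝ)) : Prop :=
  ∃ G : Model X, ∀ (k : ℕ) (c : X → ℤ) (σ : Fin k → G.Edge) (w : Fin k → ℤ) (m : G.Edge → ℤ),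
    IsDefinable (cellCoordinates G D S c σ w m)

/-- `C` is a valuated matroid of rank `r + 1` on `S` all of whose circuits give dependences. -/
def IsDependenceMatroid {X : Type u} (r : ℕ) (S : Set (X → ℝ)) (C : Set (S → WithTop ℝ)) : Prop :=
  IsValuatedMatroid C (r + 1) ∧ ∀ V ∈ C, IsDependence (fun f : S => f.1) V

/-- `S ⊆ R(D)` is a strong tropical linear series of rank `r`. -/
structure IsStrongTropicalLinearSeries {X : Type u} [MetricSpace X] (D : X →₀ ℤ) (r : ℕ)
    (S : Set (X → ℝ)) : Prop where
  series : IsTropicalLinearSeries D r S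
  closed : IsClosedSeries D S
  definable : IsDefinableSeries D S
  matroid : ∃ C : Set (S → WithTop ℝ), IsDependenceMatroid r S C

/-! ### Tropical linear spaces -/

/-- Tropical projective space `ℝ^{n+1} / ℝ(1, …, 1)`. -/
abbrev TP (n : ℕ) : Type :=
  (Fin (n + 1) → ℝ) ⧸ Submodule.span ℝ {(1 : Fin (n + 1) → ℝ)}

/-- The point `[x_0 : … : x_n]`. -/
def TP.mk {n : ℕ} (x : Fin (n + 1) → ℝ) : TP n := Submodule.Quotient.mk x

/-- The tropical linear space `B(C)` of a valuated matroid on `{0, …, n}`. -/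
def tropicalLinearSpace {n : ℕ} (C : Set (Fin (n + 1) → WithTop ℝ)) : Set (TP n) :=
  TP.mk '' {x | ∀ V ∈ C, MinTwice fun i => V i + (x i : WithTop ℝ)}

/-! ### Tropical modifications and balanced maps -/

/-- `Y` is obtained from `X` by attaching one infinite ray `[0, ∞)`, its origin being identified
with a point `p` of `X`; `ι` is the inclusion. -/
def IsElementaryModification {X Y : Type u} [MetricSpace X] [MetricSpace Y] (ι : X → Y) : Prop :=
  ∃ (p : X) (ρ : NNReal → Y), Isometry ι ∧ Isometry ρ ∧ ρ 0 = ι p ∧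
    (∀ x t, dist (ι x) (ρ t) = dist x p + t) ∧ range ι ∪ range ρ = univ

/-- `Y` is a tropical modification of `X` with inclusion `ι`: it is obtained by a finite sequence
of elementary tropical modifications. -/
inductive IsTropicalModification {X : Type u} [MetricSpace X] :
    ∀ {Y : Type u} [MetricSpace Y], (X → Y) → Prop
  | refl : IsTropicalModification (fun x : X => x)
  | step {Y Z : Type u} [MetricSpace Y] [MetricSpace Z] (ι : X → Y) (κ : Y → Z) :
      IsTropicalModification ι → IsElementaryModification κ →
      IsTropicalModification (fun x => κ (ι x))

/-- A balanced map to `TP^n`: a continuous piecewise linear map with integral slopes such that at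
every point the sum of the outgoing slopes is zero. -/
structure IsBalanced {Y : Type u} [MetricSpace Y] {n : ℕ} (Ψ : Y → TP n) : Prop where
  continuous : Continuous Ψ
  integral : ∀ (y : Y) (ζ : TangentVector y), ∃ z : Fin (n + 1) → ℤ,
    HasSlope Ψ ζ (TP.mk fun i => (z i : ℝ))
  balanced : ∀ y : Y, ∑ᶠ ζ : TangentVector y, outSlope Ψ ζ = 0

end TropicalSeries

open TropicalSeries

/-! Fix a valuated matroid `M` as in the second claim and put `x = (φ_i(v))_i` for a point `v`.
Condition (*) says that every circuit of `M` shifted by `x` attains its minimum twice, so `Φ(v)`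
lies in the tropical linear space. The sum of the outgoing slopes of `Φ` at `v` has coordinates
`-ord_v(φ_i)`. Modulo `(1, …, 1)` this is `-E_v`, where `E_v(i) = ord_v(φ_i) + D(v)` is a natural
number, and `E_v = 0` for all but finitely many `v`. Balancing `Φ` therefore means attaching rays at
`v` whose initial slopes add up to `E_v`.

Call `i` and `j` parallel at `v` when some shifted circuit attains its minimum exactly at `i` and
`j`. The dependence given by this circuit forces `φ_i - φ_j` to be constant near `v`
(`eventually_sub_eq_of_parallel`). Hence `E_v` is constant on parallel classes and is a sum of
indicator vectors of classes (`exists_multiset_parallelClass`).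

It remains to attach a ray in the direction of a class `P`. The path `x + t • ind P` stays in the
linear space as long as the elements of `P` remain parallel (`isTropicalZero_shift`). When they
first cease to be, `P` is a disjoint union of at least two classes of the new point. The ray turns
towards one of them, and the others are recorded as defects to be cancelled by later rays
(`exists_isRay`). The defects left on a ray have total cardinality less than that of `P`, so the
total cardinality of all defects drops with each attached ray and the process stops.

The restriction to the generators is a valuated matroid because elimination never leaves the union
of the two supports. -/

namespace TropicalSeries

/-! ### Arithmetic in `ℝ ∪ {∞}`. -/

section WithTopReal

theorem add_coe_le_add_coe (a b : WithTop ℝ) (c : ℝ) :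
    a + (c : WithTop ℝ) ≤ b + (c : WithTop ℝ) ↔ a ≤ b :=
  WithTop.add_le_add_iff_right WithTop.coe_ne_top

theorem add_coe_lt_add_coe (a b : WithTop ℝ) (c : ℝ) :
    a + (c : WithTop ℝ) < b + (c : WithTop ℝ) ↔ a < b :=
  WithTop.add_lt_add_iff_right WithTop.coe_ne_top

theorem add_coe_inj (a b : WithTop ℝ) (c : ℝ) :
    a + (c : WithTop ℝ) = b + (c : WithTop ℝ) ↔ a = b := by
  simp only [le_antisymm_iff, add_coe_le_add_coe]

theorem add_coe_eq_top (a : WithTop ℝ) (c : ℝ) : a + (c : WithTop ℝ) = ⊤ ↔ a = ⊤ := by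
  simp

theorem coe_lt_add_coe (b : WithTop ℝ) (a c : ℝ) :
    (a : WithTop ℝ) < b + (c : WithTop ℝ) ↔ ((a - c : ℝ) : WithTop ℝ) < b := by
  rw [← add_coe_lt_add_coe _ b c, ← WithTop.coe_add, sub_add_cancel]

theorem add_coe_eq_coe (b : WithTop ℝ) (a c : ℝ) :
    b + (c : WithTop ℝ) = (a : WithTop ℝ) ↔ b = ((a - c : ℝ) : WithTop ℝ) := by
  rw [← add_coe_inj b _ c, ← WithTop.coe_add, sub_add_cancel]

end WithTopReal

/-! ### Valuated circuits, parallel classes of the initial matroid, and moving along a class. -/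

section Circuits

variable {I : Type*}

theorem MinTwice.exists_le {g : I → WithTop ℝ} (h : MinTwice g) (l : I) : ∃ k ≠ l, g k ≤ g l := by
  obtain ⟨i, j, hij, hg, hm⟩ := h
  by_cases hi : i = l
  · exact ⟨j, fun h => hij (hi.trans h.symm), hg ▸ hm l⟩
  · exact ⟨i, hi, hm l⟩

theorem exists_lt_of_not_minTwice [Finite I] [Nonempty I] {g : I → WithTop ℝ}
    (h : ¬ MinTwice g) : ∃ l, ∀ k ≠ l, g l < g k := by
  obtain ⟨l, hl⟩ := Finite.exists_min g
  refine ⟨l, fun k hk => lt_of_le_of_ne (hl k) fun h' => h ⟨l, k, hk.symm, h', hl⟩⟩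

/-- The collection of circuits with values moved by `x`. -/
def shift (C : Set (I → WithTop ℝ)) (x : I → ℝ) : Set (I → WithTop ℝ) :=
  (fun V i => V i + (x i : WithTop ℝ)) '' C

theorem shift_shift (C : Set (I → WithTop ℝ)) (x y : I → ℝ) :
    shift (shift C x) y = shift C (x + y) := by
  simp only [shift, image_image]
  congr 1
  ext V i
  simp [add_assoc]

theorem shift_zero (C : Set (I → WithTop ℝ)) : shift C 0 = C := by
  simp [shift]

theorem supp_add_coe (V : I → WithTop ℝ) (x : I → ℝ) :
    supp (fun i => V i + (x i : WithTop ℝ)) = supp V := by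
  ext i; simp [supp]

theorem isIndependent_shift {C : Set (I → WithTop ℝ)} {x : I → ℝ} {A : Set I} :
    IsIndependent (shift C x) A ↔ IsIndependent C A := by
  simp [IsIndependent, shift, supp_add_coe]

theorem IsValuatedMatroid.shift {C : Set (I → WithTop ℝ)} {k : ℕ} (h : IsValuatedMatroid C k)
    (x : I → ℝ) : IsValuatedMatroid (shift C x) k where
  infty_notMem := by
    rintro ⟨V, hV, h'⟩
    refine h.infty_notMem ?_
    convert hV
    exact ((add_coe_eq_top _ _).1 (congrFun h' _)).symm
  add_const := by
    rintro _ ⟨V, hV, rfl⟩ a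
    refine ⟨_, h.add_const V hV a, ?_⟩
    ext i
    simp [add_right_comm]
  incomparable := by
    rintro _ ⟨V, hV, rfl⟩ _ ⟨W, hW, rfl⟩
    simpa only [supp_add_coe] using h.incomparable V hV W hW
  rank_attained := by simpa only [isIndependent_shift] using h.rank_attained
  rank_le := by simpa only [isIndependent_shift] using h.rank_le
  elimination := by
    rintro _ ⟨V, hV, rfl⟩ _ ⟨W, hW, rfl⟩ e e' he hne hlt
    obtain ⟨U, hU, h1, h2, h3⟩ := h.elimination V hV W hW e e' ((add_coe_inj _ _ _).1 he)
      (fun h => hne ((add_coe_eq_top _ _).2 h)) ((add_coe_lt_add_coe _ _ _).1 hlt)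
    refine ⟨_, ⟨U, hU, rfl⟩, (add_coe_eq_top _ _).2 h1, (add_coe_inj _ _ _).2 h2, fun i => ?_⟩
    simpa only [min_le_iff, add_coe_le_add_coe] using h3 i

/-- Valuated circuits with the same support that agree at a point of it are equal. -/
theorem IsValuatedMatroid.eq_of_supp_eq {C : Set (I → WithTop ℝ)} {k : ℕ}
    (h : IsValuatedMatroid C k) {V W : I → WithTop ℝ} (hV : V ∈ C) (hW : W ∈ C)
    (hs : supp V = supp W) {l : I} (hl : V l = W l) (hne : V l ≠ ⊤) : V = W := by
  have key : ∀ V ∈ C, ∀ W ∈ C, supp V = supp W → V l = W l → V l ≠ ⊤ → ∀ e, ¬ V e < W e := by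
    intro V hV W hW hs hl hne e he
    -- Eliminating `l` would give a circuit whose support is properly contained in that of `V`.
    obtain ⟨U, hU, h1, h2, h3⟩ := h.elimination V hV W hW l e hl hne he
    refine h.incomparable U hU V hV (fun h' => ?_) fun i hi => ?_
    · have : l ∈ supp V := hne
      rw [← h'] at this
      exact this h1
    · by_contra h'
      have hVi : V i = ⊤ := not_not.1 h'
      have hWi : W i = ⊤ := not_not.1 (fun h'' => h' (hs ▸ h''))
      have := h3 i
      rw [hVi, hWi, min_self, top_le_iff] at this
      exact hi this
  ext1 e
  exact le_antisymm (not_lt.1 (key W hW V hV hs.symm hl.symm (hl ▸ hne) e))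
    (not_lt.1 (key V hV W hW hs hl hne e))

/-- A normalised circuit is determined by its support, and a finite ground set has finitely many
subsets. This is what allows extremal choices among circuits. -/
theorem IsValuatedMatroid.finite_normalized [Finite I] {C : Set (I → WithTop ℝ)} {k : ℕ}
    (h : IsValuatedMatroid C k) (l : I) (c : ℝ) : {V ∈ C | V l = c}.Finite := by
  refine Finite.of_injOn (f := supp) (t := univ) (fun _ _ => mem_univ _) ?_ finite_univ
  intro V hV W hW hs
  exact h.eq_of_supp_eq hV.1 hW.1 hs (hV.2.trans hW.2.symm) (by simp [hV.2])

/-- Every circuit attains its minimum at least twice: the origin lies in the tropical linear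
space. -/
def IsTropicalZero (C : Set (I → WithTop ℝ)) : Prop := ∀ V ∈ C, MinTwice V

/-- `i` and `j` are parallel in the initial matroid at the origin. -/
def Parallel (C : Set (I → WithTop ℝ)) (i j : I) : Prop :=
  i = j ∨ ∃ V ∈ C, V i = 0 ∧ V j = 0 ∧ ∀ k, k ≠ i → k ≠ j → 0 < V k

theorem Parallel.symm {C : Set (I → WithTop ℝ)} {i j : I} (h : Parallel C i j) :
    Parallel C j i := by
  rcases h with rfl | ⟨V, hV, h1, h2, h3⟩
  · exact Or.inl rfl
  · exact Or.inr ⟨V, hV, h2, h1, fun k hk hk' => h3 k hk' hk⟩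

/-- Eliminating `j` between the two witnesses, while keeping the value `0` at `k`, leaves a circuit
that is positive away from `i` and `k`. Its minimum is attained twice, which forces the value `0` at
`i`. -/
theorem Parallel.trans {C : Set (I → WithTop ℝ)} {r : ℕ} (hC : IsValuatedMatroid C r)
    (h0 : IsTropicalZero C) {i j k : I} (h : Parallel C i j) (h' : Parallel C j k) :
    Parallel C i k := by
  by_cases hik : i = k
  · exact Or.inl hik
  rcases h with rfl | ⟨V, hV, h1, h2, h3⟩
  · exact h'
  rcases h' with rfl | ⟨W, hW, g1, g2, g3⟩
  · exact Or.inr ⟨V, hV, h1, h2, h3⟩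
  by_cases hij : i = j
  · subst hij; exact Or.inr ⟨W, hW, g1, g2, g3⟩
  by_cases hjk : j = k
  · subst hjk; exact Or.inr ⟨V, hV, h1, h2, h3⟩
  obtain ⟨U, hU, u1, u2, u3⟩ := hC.elimination W hW V hV j k (g1.trans h2.symm) (by simp [g1])
    (g2 ▸ h3 k (Ne.symm hik) (Ne.symm hjk))
  have hother : ∀ m, m ≠ i → m ≠ k → 0 < U m := by
    intro m hmi hmk
    by_cases hmj : m = j
    · subst hmj; rw [u1]; exact WithTop.coe_lt_top 0
    · exact lt_of_lt_of_le (lt_min (g3 m hmj hmk) (h3 m hmi hmj)) (u3 m)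
  obtain ⟨m, hmk, hm⟩ := (h0 U hU).exists_le k
  rw [u2, g2] at hm
  obtain rfl : m = i := by
    by_contra hmi
    exact absurd (hother m hmi hmk) (not_lt.2 hm)
  refine Or.inr ⟨U, hU, le_antisymm hm ?_, u2.trans g2, hother⟩
  refine le_trans (le_min (g3 m hij hik).le h1.ge) (u3 m)

/-- `P` is a class of parallel elements of the initial matroid at the origin. -/
structure IsParallelClass (C : Set (I → WithTop ℝ)) (P : Finset I) : Prop where
  nonempty : P.Nonempty
  parallel : ∀ i ∈ P, ∀ j ∈ P, Parallel C i j
  closed : ∀ i ∈ P, ∀ j, Parallel C i j → j ∈ P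

open Classical in
/-- The indicator vector of a finite set. -/
noncomputable def ind (P : Finset I) : I → ℝ := fun i => if i ∈ P then 1 else 0

theorem ind_of_mem {P : Finset I} {i : I} (h : i ∈ P) : ind P i = 1 := if_pos h

theorem ind_of_notMem {P : Finset I} {i : I} (h : i ∉ P) : ind P i = 0 := if_neg h

/-- Adding a constant to a witness moves its value on `i` and `j` to any prescribed `m`. The freedom
in `m` lets the witness be matched with another circuit before an elimination. -/
theorem parallel_shift_iff {C : Set (I → WithTop ℝ)} {r : ℕ} (hC : IsValuatedMatroid C r)
    {P : Finset I} {t : ℝ} {i j : I} (hi : i ∈ P) (hj : j ∈ P) (hij : i ≠ j) (m : ℝ) :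
    Parallel (shift C (t • ind P)) i j ↔ ∃ W ∈ C, W i = m ∧ W j = m ∧
      (∀ k ∈ P, k ≠ i → k ≠ j → (m : WithTop ℝ) < W k) ∧
      ∀ k ∉ P, ((m + t : ℝ) : WithTop ℝ) < W k := by
  constructor
  · rintro (h | ⟨_, ⟨V, hV, rfl⟩, h1, h2, h3⟩)
    · exact absurd h hij
    refine ⟨_, hC.add_const V hV (m + t), ?_, ?_, fun k hk hki hkj => ?_, fun k hk => ?_⟩
    · rw [add_coe_eq_coe]
      simp only [Pi.smul_apply, ind_of_mem hi, ← WithTop.coe_zero, add_coe_eq_coe] at h1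
      rw [h1]; congr 1; simp
    · rw [add_coe_eq_coe]
      simp only [Pi.smul_apply, ind_of_mem hj, ← WithTop.coe_zero, add_coe_eq_coe] at h2
      rw [h2]; congr 1; simp
    · have := h3 k hki hkj
      simp only [Pi.smul_apply, ind_of_mem hk, ← WithTop.coe_zero, coe_lt_add_coe] at this
      rw [coe_lt_add_coe]
      convert this using 2; simp
    · have := h3 k (fun h => hk (h ▸ hi)) (fun h => hk (h ▸ hj))
      simp only [Pi.smul_apply, ind_of_notMem hk, ← WithTop.coe_zero, coe_lt_add_coe] at this
      rw [coe_lt_add_coe]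
      convert this using 2; simp
  · rintro ⟨V, hV, h1, h2, h3, h4⟩
    refine Or.inr ⟨_, ⟨_, hC.add_const V hV (-(m + t)), rfl⟩, ?_, ?_, fun k hki hkj => ?_⟩
    · simp only [Pi.smul_apply, ind_of_mem hi, h1]
      norm_cast; simp
    · simp only [Pi.smul_apply, ind_of_mem hj, h2]
      norm_cast; simp
    · rw [← WithTop.coe_zero, coe_lt_add_coe, coe_lt_add_coe]
      by_cases hk : k ∈ P
      · convert h3 k hk hki hkj using 2; simp [ind_of_mem hk]
      · convert h4 k hk using 2; simp [ind_of_notMem hk]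

/-- Moving from a point of the tropical linear space in the direction of a class of parallel
elements, one stays in the tropical linear space while these elements are parallel. -/
theorem isTropicalZero_shift [Finite I] {C : Set (I → WithTop ℝ)} {r : ℕ}
    (hC : IsValuatedMatroid C r) (h0 : IsTropicalZero C) {P : Finset I} (hP : IsParallelClass C P)
    {t : ℝ} (ht : 0 ≤ t) (hpar : ∀ i ∈ P, ∀ j ∈ P, Parallel (shift C (t • ind P)) i j) :
    IsTropicalZero (shift C (t • ind P)) := by
  classical
  rcases ht.eq_or_lt with rfl | ht
  · rwa [zero_smul, shift_zero]
  have : Nonempty I := ⟨hP.nonempty.choose⟩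
  rintro _ ⟨V, hV, rfl⟩
  by_contra hcon
  obtain ⟨l, hl⟩ := exists_lt_of_not_minTwice hcon
  have hle : ∀ k, ((t • ind P) k : ℝ) ≤ t := by
    intro k
    by_cases hk : k ∈ P
    · simp [ind_of_mem hk]
    · simp [ind_of_notMem hk, ht.le]
  -- The shift raises the entries in `P` the most, so an entry of `P` that was not a unique minimum
  -- cannot become one.
  have hlP : l ∉ P := by
    intro hlP
    obtain ⟨k, hk, hkl⟩ := (h0 V hV).exists_le l
    refine absurd (hl k hk) (not_lt.2 ?_)
    refine add_le_add hkl (WithTop.coe_le_coe.2 ?_)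
    exact (hle k).trans (by simp [ind_of_mem hlP])
  have hVl : V l ≠ ⊤ := by
    intro h
    obtain ⟨k, hk⟩ := hP.nonempty
    have := hl k (fun h => hlP (h ▸ hk))
    simp [h] at this
  obtain ⟨c, hc⟩ := WithTop.ne_top_iff_exists.1 hVl
  -- The circuits, normalised to `0` at `l`, whose shift has its unique minimum at `l`.
  set S : Set (I → WithTop ℝ) := {V | (V ∈ C ∧ V l = (0 : ℝ)) ∧ (∀ k, k ∉ P → k ≠ l → 0 < V k) ∧
    ∀ k ∈ P, ((-t : ℝ) : WithTop ℝ) < V k} with hS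
  have hSfin : S.Finite := (hC.finite_normalized l 0).subset fun V hV => hV.1
  have hSne : S.Nonempty := by
    refine ⟨_, ⟨hC.add_const V hV (-c), ?_⟩, fun k hk hkl => ?_, fun k hk => ?_⟩
    · rw [← hc]; norm_cast; simp
    · have := hl k hkl
      simp only [Pi.smul_apply, ind_of_notMem hk, ind_of_notMem hlP, smul_zero, WithTop.coe_zero,
        add_zero, ← hc] at this
      rw [← WithTop.coe_zero, coe_lt_add_coe]; simpa using this
    · have := hl k (fun h => hlP (h ▸ hk))
      simp only [Pi.smul_apply, ind_of_mem hk, ind_of_notMem hlP, smul_zero, WithTop.coe_zero,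
        add_zero, ← hc, coe_lt_add_coe] at this
      rw [coe_lt_add_coe]; convert this using 2; simp; ring
  -- An extremal counterexample: the minimum over `P` is as large as possible and, among ties,
  -- attained as few times as possible in `P`.
  let f : (I → WithTop ℝ) → Lex (WithTop ℝ × ℕᵒᵈ) := fun V =>
    toLex (P.inf V, OrderDual.toDual (P.filter fun k => V k ≤ P.inf V).card)
  obtain ⟨V, ⟨⟨hV, hVl⟩, hV1, hV2⟩, hmax⟩ := Set.exists_max_image S f hSfin hSne
  rw [WithTop.coe_zero] at hVl
  obtain ⟨k, hkl, hk⟩ := (h0 V hV).exists_le l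
  rw [hVl] at hk
  have hkP : k ∈ P := by
    by_contra hkP
    exact absurd (hV1 k hkP hkl) (not_lt.2 hk)
  have hm0 : P.inf V ≤ 0 := (Finset.inf_le hkP).trans hk
  obtain ⟨m, hm⟩ := WithTop.ne_top_iff_exists.1 (hm0.trans_lt (WithTop.coe_lt_top 0)).ne
  obtain ⟨i, hi, hmi⟩ := Finset.exists_mem_eq_inf P hP.nonempty V
  have hinf : ∀ j ∈ P, (m : WithTop ℝ) ≤ V j := fun j hj => hm ▸ Finset.inf_le hj
  rw [← hm] at hmi hm0
  have htm : -t < m := by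
    have := hV2 i hi
    rw [← hmi] at this
    exact_mod_cast this
  by_cases hex : ∃ j ∈ P, j ≠ i ∧ V j = m
  -- If `i` and `j` both attain the minimum `m` over `P`, a witness of their parallelism after the
  -- shift, scaled to `m`, serves to eliminate `i`. It exceeds `m + t > 0` outside `P`, so the
  -- result stays in `S` and beats `V`.
  · obtain ⟨j, hj, hji, hjm⟩ := hex
    obtain ⟨W, hW, w1, w2, w3, w4⟩ :=
      (parallel_shift_iff hC hi hj (Ne.symm hji) m).1 (hpar i hi j hj)
    have w4' : ∀ k ∉ P, 0 < W k := fun k hk => lt_trans (by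
      rw [← WithTop.coe_zero, WithTop.coe_lt_coe]; linarith) (w4 k hk)
    obtain ⟨U, hU, u1, u2, u3⟩ := hC.elimination V hV W hW i l (hmi.symm.trans w1.symm)
      (by simp [← hmi]) (hVl ▸ w4' l hlP)
    have hUm : ∀ k ∈ P, (m : WithTop ℝ) ≤ U k := by
      intro k hk
      refine le_trans (le_min (hinf k hk) ?_) (u3 k)
      by_cases hki : k = i
      · rw [hki, w1]
      by_cases hkj : k = j
      · rw [hkj, w2]
      exact (w3 k hk hki hkj).le
    have hUS : U ∈ S := by
      refine ⟨⟨hU, by simp [u2, hVl]⟩, fun k hk hkl => ?_, fun k hk => ?_⟩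
      · exact lt_of_lt_of_le (lt_min (hV1 k hk hkl) (w4' k hk)) (u3 k)
      · exact lt_of_lt_of_le (WithTop.coe_lt_coe.2 htm) (hUm k hk)
    refine absurd (hmax U hUS) (not_le.2 ?_)
    rw [Prod.Lex.lt_iff]
    rcases (Finset.le_inf hUm).lt_or_eq with h | h
    · left; rw [hm] at h; exact h
    · right
      refine ⟨hm.symm.trans h, ?_⟩
      show OrderDual.toDual _ < OrderDual.toDual _
      rw [OrderDual.toDual_lt_toDual, ← h, ← hm]
      refine Finset.card_lt_card (Finset.ssubset_iff_of_subset ?_ |>.2 ⟨i, ?_, ?_⟩)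
      · intro k hk
        rw [Finset.mem_filter] at hk ⊢
        refine ⟨hk.1, ?_⟩
        by_cases hki : k = i
        · rw [hki, hmi]
        by_cases hkj : k = j
        · rw [hkj, hjm]
        rcases min_le_iff.1 ((u3 k).trans hk.2) with h | h
        · exact h
        · exact absurd (w3 k hk.1 hki hkj) (not_lt.2 h)
      · simp [hi, hmi]
      · simp [u1]
  · push Not at hex
    have hgt : ∀ j ∈ P, j ≠ i → (m : WithTop ℝ) < V j := fun j hj hji =>
      lt_of_le_of_ne (hinf j hj) (hex j hj hji).symm
    -- Now `m` is attained once in `P`. If `m < 0`, it is a unique minimum of `V`, against `h0`; if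
    -- `m = 0`, then `V` makes `l` parallel to `i`, against the closedness of `P`.
    rcases hm0.lt_or_eq with h | h
    · obtain ⟨k, hki, hk⟩ := (h0 V hV).exists_le i
      rw [← hmi] at hk
      by_cases hkP : k ∈ P
      · exact absurd (hgt k hkP hki) (not_lt.2 hk)
      by_cases hkl : k = l
      · rw [hkl, hVl] at hk; exact absurd h (not_lt.2 hk)
      · exact absurd ((hV1 k hkP hkl).trans_le hk) (not_lt.2 h.le)
    · refine hlP (hP.closed i hi l (Or.inr ⟨V, hV, hmi.symm.trans h, hVl, fun k hki hkl => ?_⟩))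
      by_cases hkP : k ∈ P
      · rw [← h]; exact hgt k hkP hki
      · exact hV1 k hkP hkl

end Circuits

/-! ### Sums of classes and the construction of rays in the tropical linear space. -/

section Rays

variable {I : Type*}

/-- Failure means that some circuit has a strict unique minimum, which finitely many open conditions
express. -/
theorem isClosed_isTropicalZero_shift [Finite I] [Nonempty I] (C : Set (I → WithTop ℝ)) :
    IsClosed {x : I → ℝ | IsTropicalZero (shift C x)} := by
  have : {x : I → ℝ | IsTropicalZero (shift C x)} =
      ⋂ V ∈ C, ⋂ l, {x | ∀ k ≠ l, V l + (x l : WithTop ℝ) < V k + (x k : WithTop ℝ)}ᶜ := by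
    ext x
    simp only [IsTropicalZero, shift, forall_mem_image, mem_ofPred_eq, mem_iInter, mem_compl_iff]
    refine forall₂_congr fun V _ => ⟨fun h l hl => ?_, fun h => ?_⟩
    · obtain ⟨k, hk, hkl⟩ := h.exists_le l
      exact absurd (hl k hk) (not_lt.2 hkl)
    · by_contra hcon
      obtain ⟨l, hl⟩ := exists_lt_of_not_minTwice hcon
      exact h l hl
  rw [this]
  refine isClosed_biInter fun V _ => isClosed_iInter fun l => IsOpen.isClosed_compl ?_
  simp only [ofPred_forall]
  refine isOpen_iInter_of_finite fun k => isOpen_iInter_of_finite fun _ => ?_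
  by_cases hl : V l = ⊤
  · simp [hl]
  by_cases hk : V k = ⊤
  · obtain ⟨a, ha⟩ := WithTop.ne_top_iff_exists.1 hl
    have : ∀ x : I → ℝ, V l + (x l : WithTop ℝ) < V k + (x k : WithTop ℝ) := by
      intro x
      rw [hk, ← ha, WithTop.top_add]
      exact WithTop.coe_lt_top (a + x l)
    simp only [this, ofPred_true, isOpen_univ]
  · obtain ⟨a, ha⟩ := WithTop.ne_top_iff_exists.1 hl
    obtain ⟨b, hb⟩ := WithTop.ne_top_iff_exists.1 hk
    simp only [← ha, ← hb, ← WithTop.coe_add, WithTop.coe_lt_coe]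
    exact isOpen_lt (by fun_prop) (by fun_prop)

open Classical in
/-- The class of elements parallel to `i`. -/
noncomputable def parallelClass [Fintype I] (C : Set (I → WithTop ℝ)) (i : I) : Finset I :=
  Finset.univ.filter (Parallel C i)

theorem mem_parallelClass [Fintype I] {C : Set (I → WithTop ℝ)} {i j : I} :
    j ∈ parallelClass C i ↔ Parallel C i j := by
  simp [parallelClass]

theorem isParallelClass_parallelClass [Fintype I] {C : Set (I → WithTop ℝ)} {r : ℕ}
    (hC : IsValuatedMatroid C r) (h0 : IsTropicalZero C) (i : I) :
    IsParallelClass C (parallelClass C i) where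
  nonempty := ⟨i, mem_parallelClass.2 (Or.inl rfl)⟩
  parallel _ hj _ hk :=
    (mem_parallelClass.1 hj).symm.trans hC h0 (mem_parallelClass.1 hk)
  closed _ hj _ hk := mem_parallelClass.2 ((mem_parallelClass.1 hj).trans hC h0 hk)

/-- A vector of natural numbers which is constant on classes of parallel elements is a sum of
indicator vectors of classes. -/
theorem exists_multiset_parallelClass [Fintype I] {C : Set (I → WithTop ℝ)} {r : ℕ}
    (hC : IsValuatedMatroid C r) (h0 : IsTropicalZero C) (E : I → ℕ)
    (hE : ∀ i j, Parallel C i j → E i = E j) :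
    ∃ L : Multiset (Finset I), (∀ P ∈ L, IsParallelClass C P) ∧
      (L.map ind).sum = (fun i => (E i : ℝ)) ∧ (L.map Finset.card).sum = ∑ i, E i := by
  classical
  induction h : ∑ i, E i using Nat.strong_induction_on generalizing E with
  | _ N ih =>
    by_cases hz : ∀ i, E i = 0
    · refine ⟨0, by simp, ?_, ?_⟩
      · ext i; simp [hz]
      · simp [← h, hz]
    · push Not at hz
      obtain ⟨i, hi⟩ := hz
      set P := parallelClass C i with hPdef
      have hP := isParallelClass_parallelClass hC h0 i
      have hEP : ∀ j ∈ P, 0 < E j := fun j hj => by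
        rw [← hE i j (mem_parallelClass.1 hj)]; omega
      -- The subtraction is never truncated: `E` is constant on `P`, hence positive there.
      let F : I → ℕ := fun j => E j - if j ∈ P then 1 else 0
      have hEF : ∀ j, E j = F j + if j ∈ P then 1 else 0 := by
        intro j
        by_cases hj : j ∈ P
        · have := hEP j hj; simp only [F, hj, if_true]; omega
        · simp [F, hj]
      have hsum : ∑ j, E j = ∑ j, F j + P.card := by
        simp only [hEF, Finset.sum_add_distrib]; simp
      have hcard : 0 < P.card := Finset.card_pos.2 hP.nonempty
      obtain ⟨L, h1, h2, h3⟩ := ih (∑ j, F j) (by omega) F (by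
        intro j k hjk
        have hmem : j ∈ P ↔ k ∈ P := ⟨fun hj => hP.closed j hj k hjk,
          fun hk => hP.closed k hk j hjk.symm⟩
        simp only [F, hE j k hjk, hmem]) rfl
      refine ⟨P ::ₘ L, ?_, ?_, ?_⟩
      · intro Q hQ
        rcases Multiset.mem_cons.1 hQ with rfl | hQ
        · exact hP
        · exact h1 Q hQ
      · rw [Multiset.map_cons, Multiset.sum_cons, h2]
        ext j
        rw [hEF j]
        by_cases hj : j ∈ P
        · simp [ind_of_mem hj, hj, add_comm]
        · simp [ind_of_notMem hj, hj]
      · rw [Multiset.map_cons, Multiset.sum_cons, h3]; omega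

/-- The vector has integral coordinates. -/
def IsIntegralVector (a : I → ℝ) : Prop := ∃ z : I → ℤ, a = fun i => (z i : ℝ)

theorem isIntegralVector_ind (P : Finset I) : IsIntegralVector (ind P) := by
  classical
  exact ⟨fun i => if i ∈ P then 1 else 0, by ext i; by_cases h : i ∈ P <;> simp [ind, h]⟩

theorem IsIntegralVector.neg {a : I → ℝ} (h : IsIntegralVector a) : IsIntegralVector (-a) := by
  obtain ⟨z, rfl⟩ := h
  exact ⟨-z, by ext; simp⟩

open Classical in
/-- The sum of the indicator vectors of the sets attached to `a`. -/
noncomputable def weight {α : Type*} (Q : Multiset (α × Finset I)) (a : α) : I → ℝ :=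
  (Q.map fun q => if q.1 = a then ind q.2 else 0).sum

section Weight

variable {α β : Type*}

@[simp] theorem weight_zero (a : α) : weight (0 : Multiset (α × Finset I)) a = 0 := by
  simp [weight]

theorem weight_add (Q Q' : Multiset (α × Finset I)) (a : α) :
    weight (Q + Q') a = weight Q a + weight Q' a := by
  simp [weight]

theorem weight_cons_self (Q : Multiset (α × Finset I)) (a : α) (P : Finset I) :
    weight ((a, P) ::ₘ Q) a = ind P + weight Q a := by
  simp [weight]

theorem weight_cons_of_ne (Q : Multiset (α × Finset I)) {a b : α} (h : b ≠ a) (P : Finset I) :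
    weight ((b, P) ::ₘ Q) a = weight Q a := by
  simp [weight, h]

theorem weight_eq_zero {Q : Multiset (α × Finset I)} {a : α} (h : ∀ q ∈ Q, q.1 ≠ a) :
    weight Q a = 0 := by
  classical
  rw [weight, Multiset.map_congr rfl (g := fun _ => 0)]
  · simp
  · intro q hq; rw [if_neg (h q hq)]

theorem weight_map_of_forall (Q : Multiset (α × Finset I)) (f : α → β) {a : α}
    (h : ∀ q ∈ Q, f q.1 = f a → q.1 = a) :
    weight (Q.map fun q => (f q.1, q.2)) (f a) = weight Q a := by
  classical
  simp only [weight, Multiset.map_map, Function.comp_def]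
  refine congrArg _ (Multiset.map_congr rfl fun q hq => ?_)
  by_cases hq' : q.1 = a
  · simp [hq']
  · rw [if_neg hq', if_neg (fun h' => hq' (h q hq h'))]

theorem weight_map_mk_self (L : Multiset (Finset I)) (a : α) :
    weight (L.map fun P => (a, P)) a = (L.map ind).sum := by
  simp [weight]

end Weight

/-- A piecewise linear path in the tropical linear space, starting at the origin in the direction
of `P`, such that at each later time the change of slope is a sum of indicator vectors of classes
of parallel elements, recorded in `L`. -/
structure IsRay (C : Set (I → WithTop ℝ)) (P : Finset I) (g : ℝ → I → ℝ)
    (L : Multiset (ℝ × Finset I)) : Prop where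
  zero : g 0 = 0
  continuous : Continuous g
  isTropicalZero : ∀ t, 0 ≤ t → IsTropicalZero (shift C (g t))
  pos : ∀ q ∈ L, 0 < q.1
  isParallelClass : ∀ q ∈ L, IsParallelClass (shift C (g q.1)) q.2
  card_lt : (L.map fun q => q.2.card).sum < P.card
  start : ∀ᶠ s in 𝓝[≥] (0 : ℝ), g s = s • ind P
  slopes : ∀ t, 0 < t → ∃ a b : I → ℝ, IsIntegralVector a ∧ IsIntegralVector b ∧
    (∀ᶠ s in 𝓝[≥] (0 : ℝ), g (t + s) = g t + s • a) ∧
    (∀ᶠ s in 𝓝[≥] (0 : ℝ), g (t - s) = g t + s • b) ∧ a + b + weight L t = 0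

theorem eventually_lt_nhdsGE_zero {δ : ℝ} (hδ : 0 < δ) :
    ∀ᶠ s in 𝓝[≥] (0 : ℝ), 0 ≤ s ∧ s < δ := by
  filter_upwards [self_mem_nhdsWithin, mem_nhdsWithin_of_mem_nhds (Iio_mem_nhds hδ)] with s h1 h2
    using ⟨h1, h2⟩

/-- With witnesses normalised to `0` on the pair, `t` enters only through the strict inequalities `t
< W k` for the finitely many `k` outside `P`, so the same witness works nearby. -/
theorem IsParallelClass.isOpen_parallel [Finite I] {C : Set (I → WithTop ℝ)} {r : ℕ}
    (hC : IsValuatedMatroid C r) (P : Finset I) :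
    IsOpen {t : ℝ | ∀ i ∈ P, ∀ j ∈ P, Parallel (shift C (t • ind P)) i j} := by
  simp only [ofPred_forall]
  refine isOpen_iInter_of_finite fun i => isOpen_iInter_of_finite fun hi =>
    isOpen_iInter_of_finite fun j => isOpen_iInter_of_finite fun hj => ?_
  by_cases hij : i = j
  · simp [hij, Parallel]
  simp only [parallel_shift_iff hC hi hj hij 0, zero_add]
  rw [isOpen_iff_mem_nhds]
  rintro t ⟨W, hW, h1, h2, h3, h4⟩
  have : ∀ᶠ s in 𝓝 t, ∀ k, k ∉ P → ((s : ℝ) : WithTop ℝ) < W k := by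
    rw [eventually_all]
    intro k
    by_cases hk : k ∈ P
    · simp [hk]
    have h := h4 k hk
    by_cases hWk : W k = ⊤
    · simp [hWk]
    · obtain ⟨a, ha⟩ := WithTop.ne_top_iff_exists.1 hWk
      rw [← ha, WithTop.coe_lt_coe] at h
      filter_upwards [Iio_mem_nhds h] with s hs _
      rw [← ha, WithTop.coe_lt_coe]
      exact hs
  filter_upwards [this] with s hs
  exact ⟨W, hW, h1, h2, h3, hs⟩

/-- When elements of a class `P` stop being parallel in direction `P`, no element outside `P`
becomes parallel to one of them. -/
theorem IsParallelClass.mem_of_parallel_shift {C : Set (I → WithTop ℝ)}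
    (h0 : IsTropicalZero C) {P : Finset I} {t : ℝ} (ht : 0 < t) {i j : I} (hi : i ∈ P)
    (h : Parallel (shift C (t • ind P)) i j) : j ∈ P := by
  by_contra hj
  rcases h with rfl | ⟨_, ⟨V, hV, rfl⟩, h1, h2, h3⟩
  · exact hj hi
  simp only [Pi.smul_apply, ind_of_mem hi, ← WithTop.coe_zero, add_coe_eq_coe] at h1
  simp only [Pi.smul_apply, ind_of_notMem hj, ← WithTop.coe_zero, add_coe_eq_coe] at h2
  -- Before the shift, `V i = -t` would be a unique minimum: the entry at `j` is `0` and all others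
  -- exceed `-t`.
  obtain ⟨k, hki, hk⟩ := (h0 V hV).exists_le i
  refine absurd hk (not_le.2 ?_)
  rw [h1]
  by_cases hkj : k = j
  · rw [hkj, h2]
    exact WithTop.coe_lt_coe.2 (by simpa using ht)
  · have := h3 k hki hkj
    simp only [Pi.smul_apply, ← WithTop.coe_zero, coe_lt_add_coe] at this
    refine lt_of_le_of_lt (WithTop.coe_le_coe.2 ?_) this
    by_cases hkP : k ∈ P
    · simp [ind_of_mem hkP]
    · simp [ind_of_notMem hkP, ht.le]

theorem isRay_of_forall_parallel [Finite I] {C : Set (I → WithTop ℝ)} {r : ℕ}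
    (hC : IsValuatedMatroid C r) (h0 : IsTropicalZero C) {P : Finset I} (hP : IsParallelClass C P)
    (h : ∀ t : ℝ, 0 ≤ t → ∀ i ∈ P, ∀ j ∈ P, Parallel (shift C (t • ind P)) i j) :
    IsRay C P (fun t => t • ind P) 0 where
  zero := by simp
  continuous := by fun_prop
  isTropicalZero t ht := isTropicalZero_shift hC h0 hP ht (h t ht)
  pos := by simp
  isParallelClass := by simp
  card_lt := by simpa [Finset.card_pos] using hP.nonempty
  start := Eventually.of_forall fun _ => rfl
  slopes t _ := ⟨ind P, -ind P, isIntegralVector_ind P, (isIntegralVector_ind P).neg,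
    Eventually.of_forall fun s => add_smul _ _ _,
    Eventually.of_forall fun s => by rw [sub_smul, smul_neg, sub_eq_add_neg], by simp⟩

/-- Continue a segment of length `t` in direction `P` by a ray in the direction of `P₁ ⊆ P`. -/
theorem IsRay.concat {C : Set (I → WithTop ℝ)} {P P₁ : Finset I} {t : ℝ} (ht : 0 < t)
    {g : ℝ → I → ℝ} {L : Multiset (ℝ × Finset I)} (hg : IsRay (shift C (t • ind P)) P₁ g L)
    (hseg : ∀ s, 0 ≤ s → s ≤ t → IsTropicalZero (shift C (s • ind P)))
    {K : Multiset (Finset I)} (hK : ∀ A ∈ K, IsParallelClass (shift C (t • ind P)) A)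
    (hsum : ind P₁ + (K.map ind).sum = ind P) (hcard : (K.map Finset.card).sum + P₁.card ≤ P.card) :
    IsRay C P (fun s => if s ≤ t then s • ind P else t • ind P + g (s - t))
      (K.map (fun A => (t, A)) + L.map fun q => (t + q.1, q.2)) := by
  set G : ℝ → I → ℝ := fun s => if s ≤ t then s • ind P else t • ind P + g (s - t) with hG
  have hle : ∀ s, s ≤ t → G s = s • ind P := fun s hs => if_pos hs
  have hge : ∀ s, t ≤ s → G s = t • ind P + g (s - t) := by
    intro s hs
    rcases hs.eq_or_lt with rfl | hs
    · rw [hle t le_rfl, sub_self, hg.zero, add_zero]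
    · exact if_neg (not_le.2 hs)
  have hweight : ∀ s, weight (L.map fun q => (t + q.1, q.2)) s = weight L (s - t) := by
    intro s
    conv_lhs => rw [← add_sub_cancel t s]
    exact weight_map_of_forall L (fun x => t + x) fun q _ h => add_left_cancel h
  constructor
  · rw [hle 0 ht.le, zero_smul]
  · have := hg.continuous
    refine Continuous.if_le (by fun_prop) (by fun_prop) continuous_id continuous_const ?_
    rintro s rfl
    simp [hg.zero]
  · intro s hs
    rcases le_total s t with h | h
    · rw [hle s h]; exact hseg s hs h
    · rw [hge s h, ← shift_shift]; exact hg.isTropicalZero _ (sub_nonneg.2 h)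
  · intro q hq
    rcases Multiset.mem_add.1 hq with h | h <;> obtain ⟨q, hq', rfl⟩ := Multiset.mem_map.1 h
    · exact ht
    · exact add_pos ht (hg.pos q hq')
  · intro q hq
    rcases Multiset.mem_add.1 hq with h | h <;> obtain ⟨q, hq', rfl⟩ := Multiset.mem_map.1 h
    · rw [hle t le_rfl]; exact hK q hq'
    · rw [hge _ (le_add_of_nonneg_right (hg.pos q hq').le), ← shift_shift, add_sub_cancel_left]
      exact hg.isParallelClass q hq'
  · have := hg.card_lt
    simp only [Multiset.map_add, Multiset.map_map, Function.comp_def, Multiset.sum_add]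
    change (K.map Finset.card).sum + _ < _
    omega
  · filter_upwards [eventually_lt_nhdsGE_zero ht] with s hs
    exact hle s hs.2.le
  · intro s hs
    simp only [weight_add, hweight]
    rcases lt_trichotomy s t with h | rfl | h
    · refine ⟨ind P, -ind P, isIntegralVector_ind P, (isIntegralVector_ind P).neg, ?_, ?_, ?_⟩
      · filter_upwards [eventually_lt_nhdsGE_zero (sub_pos.2 h)] with x hx
        rw [hle s h.le, hle _ (by linarith), add_smul]
      · filter_upwards [eventually_lt_nhdsGE_zero (sub_pos.2 h)] with x hx
        rw [hle s h.le, hle _ (by linarith), sub_smul, smul_neg, sub_eq_add_neg]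
      · rw [weight_eq_zero, weight_eq_zero]
        · simp
        · intro q hq h'; have := hg.pos q hq; linarith
        · intro q hq; obtain ⟨q, hq, rfl⟩ := Multiset.mem_map.1 hq; exact h.ne'
    -- At the bend the defect `ind P - ind P₁` is carried by the classes in `K`; `L` contributes
    -- nothing, since its times are positive.
    · refine ⟨ind P₁, -ind P, isIntegralVector_ind P₁, (isIntegralVector_ind P).neg, ?_, ?_, ?_⟩
      · filter_upwards [hg.start, eventually_lt_nhdsGE_zero ht] with x hx hx'
        rw [hge _ (by linarith), hle s le_rfl, add_sub_cancel_left, hx]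
      · filter_upwards [eventually_lt_nhdsGE_zero ht] with x hx
        rw [hle s le_rfl, hle _ (by linarith), sub_smul, smul_neg, sub_eq_add_neg]
      · rw [weight_map_mk_self, weight_eq_zero (Q := L), ← hsum]
        · abel
        · intro q hq h'; have := hg.pos q hq; linarith
    · obtain ⟨a, b, ha, hb, h1, h2, h3⟩ := hg.slopes (s - t) (sub_pos.2 h)
      refine ⟨a, b, ha, hb, ?_, ?_, ?_⟩
      · filter_upwards [h1, eventually_lt_nhdsGE_zero ht] with x hx hx'
        rw [hge _ (by linarith), hge _ h.le, add_assoc, ← hx]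
        congr 2; ring
      · filter_upwards [h2, eventually_lt_nhdsGE_zero (sub_pos.2 h)] with x hx hx'
        rw [hge _ (by linarith), hge _ h.le, add_assoc, ← hx]
        congr 2; ring
      · rw [weight_eq_zero (Q := K.map fun A => (t, A)), zero_add, h3]
        intro q hq; obtain ⟨q, hq, rfl⟩ := Multiset.mem_map.1 hq; exact h.ne

/-- Induction on `P.card`. Parallelism is an open condition on time that holds at time `0`, so
either it never fails or there is a first failure time, which is positive. There `P` is a union of
classes, each strictly smaller than `P`. -/
theorem exists_isRay [Fintype I] {C : Set (I → WithTop ℝ)} {r : ℕ} (hC : IsValuatedMatroid C r)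
    (h0 : IsTropicalZero C) {P : Finset I} (hP : IsParallelClass C P) :
    ∃ g L, IsRay C P g L := by
  classical
  induction hN : P.card using Nat.strong_induction_on generalizing C P with
  | _ N ih =>
    have : Nonempty I := ⟨hP.nonempty.choose⟩
    by_cases hall : ∀ t : ℝ, 0 ≤ t → ∀ i ∈ P, ∀ j ∈ P, Parallel (shift C (t • ind P)) i j
    · exact ⟨_, _, isRay_of_forall_parallel hC h0 hP hall⟩
    set S : Set ℝ := {t | 0 ≤ t} ∩
      {t : ℝ | ∀ i ∈ P, ∀ j ∈ P, Parallel (shift C (t • ind P)) i j}ᶜ with hS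
    have hScl : IsClosed S :=
      isClosed_Ici.inter (IsParallelClass.isOpen_parallel hC P).isClosed_compl
    have hSne : S.Nonempty := by
      push Not at hall
      obtain ⟨t, ht, i, hi, j, hj, h⟩ := hall
      exact ⟨t, ht, fun h' => h (h' i hi j hj)⟩
    have hSbdd : BddBelow S := ⟨0, fun t ht => ht.1⟩
    obtain ⟨ht0, htS⟩ := hScl.csInf_mem hSne hSbdd
    set t := sInf S with htdef
    have ht : 0 < t := by
      refine lt_of_le_of_ne ht0 fun h => htS ?_
      rw [← h]
      intro i hi j hj
      rw [zero_smul, shift_zero]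
      exact hP.parallel i hi j hj
    have hseg' : ∀ s, 0 ≤ s → s < t → IsTropicalZero (shift C (s • ind P)) := by
      intro s hs hst
      refine isTropicalZero_shift hC h0 hP hs ?_
      by_contra hcon
      exact absurd (csInf_le hSbdd ⟨hs, hcon⟩) (not_le.2 hst)
    -- Parallelism fails at the endpoint `t`, so membership there comes from closedness.
    have hseg : ∀ s, 0 ≤ s → s ≤ t → IsTropicalZero (shift C (s • ind P)) := by
      have hcl : IsClosed {s : ℝ | IsTropicalZero (shift C (s • ind P))} :=
        (isClosed_isTropicalZero_shift C).preimage (by fun_prop : Continuous fun s : ℝ => s • ind P)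
      have hsub : Ico 0 t ⊆ {s : ℝ | IsTropicalZero (shift C (s • ind P))} :=
        fun s hs => hseg' s hs.1 hs.2
      have := hcl.closure_subset_iff.2 hsub
      rw [closure_Ico ht.ne] at this
      exact fun s hs hst => this ⟨hs, hst⟩
    have hC' := hC.shift (t • ind P)
    have h0' := hseg t ht0 le_rfl
    obtain ⟨i, hi⟩ := hP.nonempty
    set P₁ := parallelClass (shift C (t • ind P)) i
    have hP₁ : IsParallelClass _ P₁ := isParallelClass_parallelClass hC' h0' i
    have hsub : P₁ ⊆ P := fun j hj =>
      IsParallelClass.mem_of_parallel_shift h0 ht hi (mem_parallelClass.1 hj)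
    have hssub : P₁ ⊂ P := by
      refine hsub.ssubset_of_ne fun h => htS ?_
      have := hP₁.parallel
      rwa [h] at this
    have hlt := Finset.card_lt_card hssub
    obtain ⟨g, L, hg⟩ := ih P₁.card (hN ▸ hlt) hC' h0' hP₁ rfl
    -- No class at the new point crosses the boundary of `P`, so `P \ P₁` splits into classes.
    obtain ⟨K, hK, hK1, hK2⟩ := exists_multiset_parallelClass hC' h0'
      (fun j => if j ∈ P \ P₁ then 1 else 0) (by
        intro j k hjk
        have h1 : j ∈ P ↔ k ∈ P := ⟨fun h => IsParallelClass.mem_of_parallel_shift h0 ht h hjk,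
          fun h => IsParallelClass.mem_of_parallel_shift h0 ht h hjk.symm⟩
        have h2 : j ∈ P₁ ↔ k ∈ P₁ := ⟨fun h => hP₁.closed j h k hjk,
          fun h => hP₁.closed k h j hjk.symm⟩
        simp only [Finset.mem_sdiff, h1, h2])
    refine ⟨_, _, hg.concat ht hseg hK ?_ ?_⟩
    · rw [hK1]
      ext j
      by_cases h1 : j ∈ P₁
      · simp [ind, h1, hsub h1]
      · by_cases h2 : j ∈ P <;> simp [ind, h1, h2]
    · rw [hK2]
      have := Finset.card_sdiff_add_card_eq_card hsub
      simp only [Finset.sum_ite_mem, Finset.univ_inter, Finset.sum_const, smul_eq_mul, mul_one]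
      exact this.le

end Rays

/-! ### Star neighbourhoods, tangent vectors and the computation of slopes. -/

section Stars

variable {Y : Type u} [MetricSpace Y]

/-- A ball around `v` is a star with the given arms. -/
structure IsStar {J : Type*} (v : Y) (ε : ℝ) (arm : J → ℝ → Y) : Prop where
  pos : 0 < ε
  zero : ∀ j, arm j 0 = v
  isometry : ∀ j, ∀ s ∈ Ico 0 ε, ∀ t ∈ Ico 0 ε, dist (arm j s) (arm j t) = |s - t|
  cross : ∀ i j, i ≠ j → ∀ s ∈ Ico 0 ε, ∀ t ∈ Ico 0 ε, dist (arm i s) (arm j t) = s + t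
  cover : ∀ y, dist y v < ε → y = v ∨ ∃ j, ∃ t ∈ Ico 0 ε, y = arm j t

variable {J : Type*} {v : Y} {ε : ℝ} {arm : J → ℝ → Y}

theorem IsStar.dist_center (h : IsStar v ε arm) (j : J) {t : ℝ} (ht : t ∈ Ico 0 ε) :
    dist (arm j t) v = t := by
  rw [← h.zero j, h.isometry j t ht 0 ⟨le_rfl, h.pos⟩, sub_zero, abs_of_nonneg ht.1]

/-- The arms of a star as segments. -/
def IsStar.segment (h : IsStar v ε arm) (j : J) : Segment v :=
  ⟨arm j, h.zero j, ε / 2, half_pos h.pos, fun s hs t ht =>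
    h.isometry j s ⟨hs.1, hs.2.trans_lt (half_lt_self h.pos)⟩ t
      ⟨ht.1, ht.2.trans_lt (half_lt_self h.pos)⟩⟩

/-- A geodesic from `v` cannot change arms: points at heights `t` and `t₀` on different arms are at
distance `t + t₀`, not `t₀ - t`. So every tangent vector is that of exactly one arm. -/
theorem IsStar.bijective (h : IsStar v ε arm) :
    Function.Bijective fun j => Quotient.mk (segmentSetoid v) (h.segment j) := by
  constructor
  · intro i j hij
    by_contra hne
    have h1 : ∀ᶠ t in 𝓝[≥] (0 : ℝ), arm i t = arm j t := Quotient.exact hij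
    have h2 : ∀ᶠ t in 𝓝[>] (0 : ℝ), arm i t = arm j t :=
      h1.filter_mono (nhdsWithin_mono _ Ioi_subset_Ici_self)
    obtain ⟨t, ht, ht0, htε⟩ := (h2.and (Ioo_mem_nhdsGT h.pos)).exists
    have := h.cross i j hne t ⟨ht0.le, htε⟩ t ⟨ht0.le, htε⟩
    rw [ht, dist_self] at this
    linarith
  · intro ζ
    induction ζ using Quotient.inductionOn with
    | _ γ =>
    obtain ⟨γ, hγ0, δ, hδ, hγ⟩ := γ
    have hdist : ∀ t ∈ Icc 0 δ, dist (γ t) v = t := fun t ht => by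
      rw [← hγ0, hγ t ht 0 ⟨le_rfl, hδ.le⟩, sub_zero, abs_of_nonneg ht.1]
    have harm : ∀ t, 0 < t → t ≤ δ → t < ε → ∃ j, γ t = arm j t := by
      intro t ht htδ htε
      have hd := hdist t ⟨ht.le, htδ⟩
      rcases h.cover (γ t) (hd.trans_lt htε) with h' | ⟨j, s, hs, h'⟩
      · rw [h', dist_self] at hd; exact absurd hd ht.ne
      · refine ⟨j, ?_⟩
        rw [h', h.dist_center j hs] at hd
        rw [h', hd]
    set t₀ := min δ (ε / 2)
    have ht₀ : 0 < t₀ := lt_min hδ (half_pos h.pos)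
    have ht₀δ : t₀ ≤ δ := min_le_left _ _
    have ht₀ε : t₀ < ε := (min_le_right _ _).trans_lt (half_lt_self h.pos)
    obtain ⟨j, hj⟩ := harm t₀ ht₀ ht₀δ ht₀ε
    refine ⟨j, Quotient.sound (s := segmentSetoid v) ?_⟩
    show ∀ᶠ t in 𝓝[≥] (0 : ℝ), arm j t = γ t
    filter_upwards [eventually_lt_nhdsGE_zero ht₀] with t ht
    rcases ht.1.eq_or_lt with rfl | ht'
    · rw [h.zero, hγ0]
    obtain ⟨i, hi⟩ := harm t ht' (ht.2.le.trans ht₀δ) (ht.2.trans ht₀ε)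
    by_cases hij : i = j
    · rw [hi, hij]
    have h1 := h.cross i j hij t ⟨ht.1, ht.2.trans ht₀ε⟩ t₀ ⟨ht₀.le, ht₀ε⟩
    rw [← hi, ← hj, hγ t ⟨ht.1, ht.2.le.trans ht₀δ⟩ t₀ ⟨ht₀.le, ht₀δ⟩, abs_of_neg (by linarith)]
      at h1
    linarith

variable {W : Type*} [AddCommGroup W] [Module ℝ W]

theorem IsStar.hasSlope (h : IsStar v ε arm) {f : Y → W} {j : J} {s : W}
    (hs : ∀ᶠ t in 𝓝[≥] (0 : ℝ), f (arm j t) = f v + t • s) :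
    HasSlope f (Quotient.mk (segmentSetoid v) (h.segment j)) s :=
  ⟨h.segment j, rfl, hs⟩

theorem IsStar.eventually_of_hasSlope (h : IsStar v ε arm) {f : Y → W} {j : J} {s : W}
    (hs : HasSlope f (Quotient.mk (segmentSetoid v) (h.segment j)) s) :
    ∀ᶠ t in 𝓝[≥] (0 : ℝ), f (arm j t) = f v + t • s := by
  obtain ⟨γ, hγ, hs⟩ := hs
  have h1 : ∀ᶠ t in 𝓝[≥] (0 : ℝ), γ.1 t = arm j t := Quotient.exact hγ
  filter_upwards [h1, hs] with t h1 h2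
  rw [← h1, h2]

theorem eq_of_eventually_smul_eq {s s' : W} (h : ∀ᶠ t in 𝓝[≥] (0 : ℝ), t • s = t • s') :
    s = s' := by
  have h2 := h.filter_mono (nhdsWithin_mono _ Ioi_subset_Ici_self)
  obtain ⟨t, ht, ht0⟩ := (h2.and self_mem_nhdsWithin).exists
  have ht0 : t ≠ 0 := ne_of_gt ht0
  have := congrArg (fun w => t⁻¹ • w) ht
  simpa [smul_smul, ht0] using this

/-- This makes the choice in `outSlope` harmless. -/
theorem HasSlope.unique {f : Y → W} {ζ : TangentVector v} {s s' : W} (h : HasSlope f ζ s)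
    (h' : HasSlope f ζ s') : s = s' := by
  obtain ⟨γ, rfl, h⟩ := h
  obtain ⟨γ', hγ, h'⟩ := h'
  have h1 : ∀ᶠ t in 𝓝[≥] (0 : ℝ), γ'.1 t = γ.1 t := Quotient.exact hγ
  refine eq_of_eventually_smul_eq ?_
  filter_upwards [h, h', h1] with t h h' h1
  rw [h1, h] at h'
  exact add_left_cancel h'

theorem HasSlope.outSlope_eq {f : Y → W} {ζ : TangentVector v} {s : W} (h : HasSlope f ζ s) :
    outSlope f ζ = s := by
  have hex : ∃ s, HasSlope f ζ s := ⟨s, h⟩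
  rw [outSlope, dif_pos hex]
  exact hex.choose_spec.unique h

theorem IsStar.finsum_outSlope [Fintype J] (h : IsStar v ε arm) {f : Y → W} {s : J → W}
    (hs : ∀ j, ∀ᶠ t in 𝓝[≥] (0 : ℝ), f (arm j t) = f v + t • s j) :
    ∑ᶠ ζ : TangentVector v, outSlope f ζ = ∑ j, s j := by
  rw [← finsum_eq_sum_of_fintype]
  exact (finsum_eq_of_bijective _ h.bijective fun j => (h.hasSlope (hs j)).outSlope_eq.symm).symm

/-- A point inside a segment is the center of a star with two arms. -/
theorem isStar_of_line (c : ℝ → Y) {δ : ℝ} (hδ : 0 < δ)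
    (hc : ∀ s ∈ Ioo (-δ) δ, ∀ t ∈ Ioo (-δ) δ, dist (c s) (c t) = |s - t|)
    (hcov : ∀ y, dist y (c 0) < δ → ∃ t ∈ Ioo (-δ) δ, y = c t) :
    IsStar (c 0) δ (fun (b : Bool) t => c (if b then t else -t)) where
  pos := hδ
  zero b := by cases b <;> simp
  isometry b s hs t ht := by
    have := hs.1; have := hs.2; have := ht.1; have := ht.2
    cases b
    · simp only [Bool.false_eq_true, if_false]
      rw [hc _ ⟨by linarith, by linarith⟩ _ ⟨by linarith, by linarith⟩, neg_sub_neg, abs_sub_comm]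
    · simp only [if_true]
      rw [hc _ ⟨by linarith, by linarith⟩ _ ⟨by linarith, by linarith⟩]
  cross b b' hb s hs t ht := by
    have := hs.1; have := hs.2; have := ht.1; have := ht.2
    cases b <;> cases b' <;> simp only [ne_eq, not_true, reduceCtorEq, not_false_eq_true] at hb
    · simp only [Bool.false_eq_true, if_false, if_true]
      rw [hc _ ⟨by linarith, by linarith⟩ _ ⟨by linarith, by linarith⟩,
        abs_of_nonpos (by linarith)]
      ring
    · simp only [Bool.false_eq_true, if_false, if_true]
      rw [hc _ ⟨by linarith, by linarith⟩ _ ⟨by linarith, by linarith⟩,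
        abs_of_nonneg (by linarith)]
      ring
  cover y hy := by
    obtain ⟨t, ht, rfl⟩ := hcov y hy
    right
    rcases le_total 0 t with h | h
    · exact ⟨true, t, ⟨h, ht.2⟩, by simp⟩
    · exact ⟨false, -t, ⟨by linarith, by linarith [ht.1]⟩, by simp⟩

end Stars

/-! ### Attaching an infinite ray to a metric space. -/

section AttachedRay

variable {Y : Type u}

/-- The space obtained from `Y` by attaching an infinite ray at `p`. -/
abbrev AttachedRay (p : Y) : Type u := {q : WithLp 1 (Y × NNReal) // q.snd = 0 ∨ q.fst = p}

namespace AttachedRay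

variable {p : Y}

/-- The inclusion of the original space. -/
def base (p y : Y) : AttachedRay p := ⟨WithLp.toLp 1 (y, 0), Or.inl rfl⟩

/-- The inclusion of the ray. -/
def ray (p : Y) (t : NNReal) : AttachedRay p := ⟨WithLp.toLp 1 (p, t), Or.inr rfl⟩

theorem ray_zero : ray p 0 = base p p := rfl

theorem eq_base_or_ray (z : AttachedRay p) : (∃ y, z = base p y) ∨ ∃ t, 0 < t ∧ z = ray p t := by
  obtain ⟨⟨⟨y, t⟩⟩, h⟩ := z
  by_cases ht : t = 0
  · subst ht; exact Or.inl ⟨y, rfl⟩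
  · obtain rfl : y = p := h.resolve_left ht
    exact Or.inr ⟨t, pos_iff_ne_zero.2 ht, rfl⟩

variable [MetricSpace Y]

/-- The `L¹` metric gives the glued metric: passing from the base to the ray costs the distance to
`p` plus the height. -/
theorem dist_eq (z w : AttachedRay p) :
    dist z w = dist z.1.fst w.1.fst + dist z.1.snd w.1.snd := by
  rw [Subtype.dist_eq, WithLp.prod_dist_eq_add (by simp)]
  simp

theorem dist_base_base (y y' : Y) : dist (base p y) (base p y') = dist y y' := by
  simp [dist_eq, base]

theorem dist_ray_ray (s t : NNReal) : dist (ray p s) (ray p t) = |(s : ℝ) - t| := by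
  simp [dist_eq, ray, NNReal.dist_eq]

theorem dist_base_ray (y : Y) (t : NNReal) : dist (base p y) (ray p t) = dist y p + t := by
  simp [dist_eq, base, ray, NNReal.dist_eq]

theorem base_injective : Function.Injective (base p) := by
  intro y y' h
  rw [← dist_eq_zero, ← dist_base_base (p := p), h, dist_self]

theorem isElementaryModification : IsElementaryModification (base p) := by
  refine ⟨p, ray p, Isometry.of_dist_eq dist_base_base, Isometry.of_dist_eq fun s t => ?_, rfl,
    dist_base_ray, ?_⟩
  · rw [dist_ray_ray, NNReal.dist_eq]
  · ext z
    rcases eq_base_or_ray z with ⟨y, rfl⟩ | ⟨t, -, rfl⟩ <;> simp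

/-- The radius is cut down to `dist y p` so that the ball misses the ray. -/
theorem isStar_base_of_ne {J : Type*} {y : Y} (hy : y ≠ p) {ε : ℝ} {arm : J → ℝ → Y}
    (h : IsStar y ε arm) : IsStar (base p y) (min ε (dist y p)) fun j t => base p (arm j t) := by
  have hsub : ∀ t, t ∈ Ico 0 (min ε (dist y p)) → t ∈ Ico 0 ε := fun t ht =>
    ⟨ht.1, ht.2.trans_le (min_le_left _ _)⟩
  refine ⟨lt_min h.pos (dist_pos.2 hy), fun j => by rw [h.zero], fun j s hs t ht => ?_,
    fun i j hij s hs t ht => ?_, fun z hz => ?_⟩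
  · rw [dist_base_base, h.isometry j s (hsub s hs) t (hsub t ht)]
  · rw [dist_base_base, h.cross i j hij s (hsub s hs) t (hsub t ht)]
  · rcases eq_base_or_ray z with ⟨y', rfl⟩ | ⟨t, -, rfl⟩
    · rw [dist_base_base] at hz
      rcases h.cover y' (hz.trans_le (min_le_left _ _)) with rfl | ⟨j, t, ht, rfl⟩
      · exact Or.inl rfl
      · refine Or.inr ⟨j, t, ⟨ht.1, ?_⟩, rfl⟩
        rwa [h.dist_center j ht] at hz
    · rw [dist_comm, dist_base_ray] at hz
      have := min_le_right ε (dist y p)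
      have : (0 : ℝ) ≤ t := t.2
      linarith

theorem isStar_base_self {J : Type*} {ε : ℝ} {arm : J → ℝ → Y} (h : IsStar p ε arm) :
    IsStar (base p p) ε fun (o : Option J) t =>
      o.elim (ray p t.toNNReal) fun j => base p (arm j t) := by
  refine ⟨h.pos, fun j => ?_, fun j s hs t ht => ?_, fun i j hij s hs t ht => ?_, fun z hz => ?_⟩
  · cases j with
    | none => simp [ray_zero]
    | some j => simp [h.zero]
  · cases j with
    | none => simp [dist_ray_ray, hs.1, ht.1]
    | some j => simp [dist_base_base, h.isometry j s hs t ht]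
  · cases i with
    | none =>
      cases j with
      | none => exact absurd rfl hij
      | some j => simp [dist_comm (ray _ _), dist_base_ray, h.dist_center j ht, hs.1, add_comm]
    | some i =>
      cases j with
      | none => simp [dist_base_ray, h.dist_center i hs, ht.1]
      | some j => simp [dist_base_base, h.cross i j (fun h => hij (h ▸ rfl)) s hs t ht]
  · rcases eq_base_or_ray z with ⟨y', rfl⟩ | ⟨t, -, rfl⟩
    · rw [dist_base_base] at hz
      rcases h.cover y' hz with rfl | ⟨j, t, ht, rfl⟩
      · exact Or.inl rfl
      · exact Or.inr ⟨some j, t, ht, rfl⟩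
    · rw [dist_comm, dist_base_ray, dist_self, zero_add] at hz
      exact Or.inr ⟨none, t, ⟨t.2, hz⟩, by simp⟩

theorem isStar_ray {t : NNReal} (ht : 0 < t) :
    IsStar (ray p t) t fun (b : Bool) s => ray p (t + if b then s else -s : ℝ).toNNReal := by
  have ht' : (0 : ℝ) < t := ht
  have := isStar_of_line (fun s => ray p (t + s : ℝ).toNNReal) ht' (fun s hs u hu => ?_)
    fun z hz => ?_
  · simpa using this
  · have := hs.1; have := hu.1
    rw [dist_ray_ray, Real.coe_toNNReal _ (by linarith), Real.coe_toNNReal _ (by linarith)]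
    congr 1; ring
  · simp only [add_zero, Real.toNNReal_coe] at hz
    rcases eq_base_or_ray z with ⟨y, rfl⟩ | ⟨u, -, rfl⟩
    · rw [dist_base_ray] at hz
      have := dist_nonneg (x := y) (y := p)
      linarith
    · rw [dist_ray_ray, abs_lt] at hz
      exact ⟨u - t, ⟨hz.1, hz.2⟩, by simp⟩

theorem continuous_fst : Continuous fun z : AttachedRay p => z.1.fst :=
  LipschitzWith.continuous (K := 1) <| LipschitzWith.of_dist_le_mul fun z w => by
    rw [dist_eq]; simp

theorem continuous_snd : Continuous fun z : AttachedRay p => z.1.snd :=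
  LipschitzWith.continuous (K := 1) <| LipschitzWith.of_dist_le_mul fun z w => by
    rw [dist_eq]; simp

end AttachedRay

end AttachedRay

/-! ### Tropical projective space as a quotient vector space. -/

section TropicalProjectiveSpace

variable {n : ℕ}

theorem TP.mk_add (x y : Fin (n + 1) → ℝ) : TP.mk (x + y) = TP.mk x + TP.mk y := rfl

theorem TP.mk_smul (t : ℝ) (x : Fin (n + 1) → ℝ) : TP.mk (t • x) = t • TP.mk x := rfl

theorem TP.mk_zero : TP.mk (0 : Fin (n + 1) → ℝ) = 0 := rfl

theorem TP.mk_sum {J : Type*} (F : Finset J) (s : J → Fin (n + 1) → ℝ) :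
    TP.mk (∑ j ∈ F, s j) = ∑ j ∈ F, TP.mk (s j) :=
  map_sum (Submodule.mkQ (Submodule.span ℝ {(1 : Fin (n + 1) → ℝ)})) s F

theorem TP.mk_const (c : ℝ) : TP.mk (fun _ : Fin (n + 1) => c) = 0 := by
  refine (Submodule.Quotient.mk_eq_zero _).2 (Submodule.mem_span_singleton.2 ⟨c, ?_⟩)
  ext; simp

theorem TP.continuous_mk : Continuous (TP.mk (n := n)) := continuous_quot_mk

theorem mem_tropicalLinearSpace {M : Set (Fin (n + 1) → WithTop ℝ)} {y : TP n} :
    y ∈ tropicalLinearSpace M ↔ ∃ x, TP.mk x = y ∧ IsTropicalZero (shift M x) := by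
  simp only [IsTropicalZero, shift, forall_mem_image]
  exact ⟨fun ⟨x, hx, h⟩ => ⟨x, h, fun V hV => hx V hV⟩,
    fun ⟨x, h, hx⟩ => ⟨x, fun V hV => hx hV, h⟩⟩

end TropicalProjectiveSpace

/-! ### Cancelling the defects one ray at a time. -/

section Extension

variable {n : ℕ} {Y : Type u} [MetricSpace Y]

/-- A continuous piecewise linear map to the tropical linear space with integral slopes, such
that at each point the sum of the outgoing slopes is minus the sum of the indicator vectors of the
classes of parallel elements attached to that point in `Q`. -/
structure IsBalancedUpTo (M : Set (Fin (n + 1) → WithTop ℝ)) (Ψ : Y → TP n)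
    (Q : Multiset (Y × Finset (Fin (n + 1)))) : Prop where
  continuous : Continuous Ψ
  mem : ∀ y, Ψ y ∈ tropicalLinearSpace M
  isParallelClass : ∀ q ∈ Q, ∃ x, TP.mk x = Ψ q.1 ∧ IsTropicalZero (shift M x) ∧
    IsParallelClass (shift M x) q.2
  star : ∀ y, ∃ (J : Type) (_ : Fintype J) (ε : ℝ) (arm : J → ℝ → Y) (s : J → Fin (n + 1) → ℝ),
    IsStar y ε arm ∧ (∀ j, IsIntegralVector (s j)) ∧
    (∀ j, ∀ᶠ t in 𝓝[≥] (0 : ℝ), Ψ (arm j t) = Ψ y + t • TP.mk (s j)) ∧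
    TP.mk (∑ j, s j + weight Q y) = 0

theorem IsBalancedUpTo.isBalanced {M : Set (Fin (n + 1) → WithTop ℝ)} {Ψ : Y → TP n}
    (h : IsBalancedUpTo M Ψ 0) : IsBalanced Ψ where
  continuous := h.continuous
  integral y ζ := by
    obtain ⟨J, _, ε, arm, s, h1, h2, h3, -⟩ := h.star y
    obtain ⟨j, rfl⟩ := h1.bijective.2 ζ
    obtain ⟨z, hz⟩ := h2 j
    exact ⟨z, hz ▸ h1.hasSlope (h3 j)⟩
  balanced y := by
    obtain ⟨J, _, ε, arm, s, h1, -, h3, h4⟩ := h.star y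
    rw [h1.finsum_outSlope h3, ← TP.mk_sum]
    simpa using h4

/-- Attach one ray to cancel one of the classes, at the cost of smaller ones on the ray. -/
theorem IsBalancedUpTo.exists_attachedRay {M : Set (Fin (n + 1) → WithTop ℝ)} {r : ℕ}
    (hM : IsValuatedMatroid M r) {Ψ : Y → TP n} {p : Y} {P : Finset (Fin (n + 1))}
    {Q : Multiset (Y × Finset (Fin (n + 1)))} (h : IsBalancedUpTo M Ψ ((p, P) ::ₘ Q)) :
    ∃ (Ψ' : AttachedRay p → TP n) (Q' : Multiset (AttachedRay p × Finset (Fin (n + 1)))),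
      (∀ y, Ψ' (AttachedRay.base p y) = Ψ y) ∧ IsBalancedUpTo M Ψ' Q' ∧
      (Q'.map fun q => q.2.card).sum < (((p, P) ::ₘ Q).map fun q => q.2.card).sum := by
  obtain ⟨x, hx, hx0, hxP⟩ := h.isParallelClass (p, P) (Multiset.mem_cons_self _ _)
  simp only at hx hxP
  obtain ⟨g, L, hg⟩ := exists_isRay (hM.shift x) hx0 hxP
  -- One formula covers both pieces: the second coordinate is `0` on the base, where `g 0 = 0`, and
  -- the first is `p` on the ray.
  let Ψ' : AttachedRay p → TP n := fun z => Ψ z.1.fst + TP.mk (g z.1.snd)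
  have hbase : ∀ y, Ψ' (AttachedRay.base p y) = Ψ y := fun y => by
    simp [Ψ', AttachedRay.base, hg.zero, TP.mk_zero]
  have hray : ∀ t, Ψ' (AttachedRay.ray p t) = TP.mk (x + g t) := fun t => by
    simp [Ψ', AttachedRay.ray, TP.mk_add, hx]
  have hray' : ∀ t : ℝ, 0 ≤ t → Ψ' (AttachedRay.ray p t.toNNReal) = TP.mk (x + g t) :=
    fun t ht => by rw [hray, Real.coe_toNNReal t ht]
  let QL : Multiset (AttachedRay p × Finset (Fin (n + 1))) :=
    L.map fun q => (AttachedRay.ray p q.1.toNNReal, q.2)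
  let QY : Multiset (AttachedRay p × Finset (Fin (n + 1))) :=
    Q.map fun q => (AttachedRay.base p q.1, q.2)
  have hne : ∀ y (t : NNReal), 0 < t → AttachedRay.base p y ≠ AttachedRay.ray p t := by
    intro y t ht heq
    have h1 := AttachedRay.dist_base_ray (p := p) y t
    rw [heq, dist_self] at h1
    have h2 := dist_nonneg (x := y) (y := p)
    have h3 : (0 : ℝ) < t := ht
    linarith
  have hwL : ∀ y, weight QL (AttachedRay.base p y) = 0 := by
    intro y
    refine weight_eq_zero fun q hq => ?_
    obtain ⟨q, hq', rfl⟩ := Multiset.mem_map.1 hq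
    exact (hne y _ (Real.toNNReal_pos.2 (hg.pos q hq'))).symm
  have hwY : ∀ y, weight QY (AttachedRay.base p y) = weight Q y := fun y =>
    weight_map_of_forall Q _ fun q _ h => AttachedRay.base_injective h
  refine ⟨Ψ', QL + QY, hbase, ⟨?_, fun z => ?_, fun q hq => ?_, fun z => ?_⟩, ?_⟩
  · exact (h.continuous.comp AttachedRay.continuous_fst).add (TP.continuous_mk.comp
      (hg.continuous.comp (NNReal.continuous_coe.comp AttachedRay.continuous_snd)))
  · rcases AttachedRay.eq_base_or_ray z with ⟨y, rfl⟩ | ⟨t, ht, rfl⟩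
    · rw [hbase]; exact h.mem y
    · rw [hray]
      exact mem_tropicalLinearSpace.2 ⟨_, rfl, by
        rw [← shift_shift]; exact hg.isTropicalZero t t.2⟩
  · rcases Multiset.mem_add.1 hq with hq | hq <;> obtain ⟨q, hq', rfl⟩ := Multiset.mem_map.1 hq
    · have h0 := (hg.pos q hq').le
      refine ⟨x + g q.1, (hray' _ h0).symm, ?_⟩
      rw [← shift_shift]
      exact ⟨hg.isTropicalZero _ h0, hg.isParallelClass q hq'⟩
    · obtain ⟨x', h1, h2⟩ := h.isParallelClass q (Multiset.mem_cons_of_mem hq')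
      exact ⟨x', h1.trans (hbase _).symm, h2⟩
  · rcases AttachedRay.eq_base_or_ray z with ⟨y, rfl⟩ | ⟨t, ht, rfl⟩
    · obtain ⟨J, _, ε, arm, s, h1, h2, h3, h4⟩ := h.star y
      rw [weight_add, hwL, hwY, zero_add, hbase]
      by_cases hy : y = p
      -- The new arm has slope `ind P`, which replaces the class removed from the list of defects at
      -- `p`.
      · subst hy
        refine ⟨Option J, inferInstance, ε, _, fun o => o.elim (ind P) s,
          AttachedRay.isStar_base_self h1, fun o => ?_, fun o => ?_, ?_⟩
        · cases o with
          | none => exact isIntegralVector_ind P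
          | some j => exact h2 j
        · cases o with
          | none =>
            filter_upwards [hg.start, self_mem_nhdsWithin] with t ht ht0
            simp only [Option.elim_none]
            rw [hray' t ht0, ht, TP.mk_add, hx, TP.mk_smul]
          | some j =>
            filter_upwards [h3 j] with t ht
            simp only [Option.elim_some]
            rw [hbase, ht]
        · rw [weight_cons_self] at h4
          rw [Fintype.sum_option, ← h4]
          congr 1
          simp only [Option.elim_none, Option.elim_some]
          abel
      · rw [weight_cons_of_ne _ (Ne.symm hy)] at h4
        refine ⟨J, inferInstance, _, _, s, AttachedRay.isStar_base_of_ne hy h1, h2, fun j => ?_, h4⟩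
        filter_upwards [h3 j] with t ht
        rw [hbase, ht]
    · have ht' : (0 : ℝ) < t := ht
      obtain ⟨a, b, ha, hb, h1, h2, h3⟩ := hg.slopes t ht'
      refine ⟨Bool, inferInstance, _, _, fun c => if c then a else b, AttachedRay.isStar_ray ht,
        fun c => ?_, fun c => ?_, ?_⟩
      · cases c
        · exact hb
        · exact ha
      · cases c
        · filter_upwards [h2, eventually_lt_nhdsGE_zero ht'] with s hs hs'
          simp only [Bool.false_eq_true, if_false, ← sub_eq_add_neg]
          rw [hray' _ (by linarith), hray, hs, ← TP.mk_smul, ← TP.mk_add, add_assoc]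
        · filter_upwards [h1, eventually_lt_nhdsGE_zero ht'] with s hs hs'
          simp only [if_true]
          rw [hray' _ (by linarith), hray, hs, ← TP.mk_smul, ← TP.mk_add, add_assoc]
      · have hY : weight QY (AttachedRay.ray p t) = 0 := by
          refine weight_eq_zero fun q hq => ?_
          obtain ⟨q, hq', rfl⟩ := Multiset.mem_map.1 hq
          exact hne _ _ ht
        have hL : weight QL (AttachedRay.ray p t) = weight L t := by
          have := weight_map_of_forall L (fun s : ℝ => AttachedRay.ray p s.toNNReal)
            (a := (t : ℝ)) fun q hq heq => by
              have h5 : dist (AttachedRay.ray p q.1.toNNReal) (AttachedRay.ray p (t : ℝ).toNNReal)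
                = 0 := by rw [heq, dist_self]
              rw [AttachedRay.dist_ray_ray, Real.coe_toNNReal _ (hg.pos q hq).le,
                Real.toNNReal_coe, abs_eq_zero] at h5
              linarith
          simpa only [Real.toNNReal_coe] using this
        rw [weight_add, hY, hL, add_zero, Fintype.sum_bool]
        simp only [if_true, Bool.false_eq_true, if_false, h3, TP.mk_zero]
  · have := hg.card_lt
    simp only [QL, QY, Multiset.map_add, Multiset.map_map, Function.comp_def, Multiset.sum_add,
      Multiset.map_cons, Multiset.sum_cons]
    omega

/-- Induction on the total cardinality of the defects, with the space itself varying. -/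
theorem exists_isTropicalModification_isBalanced {X : Type u} [MetricSpace X]
    {M : Set (Fin (n + 1) → WithTop ℝ)} {r : ℕ} (hM : IsValuatedMatroid M r) {Y : Type u}
    [MetricSpace Y] {ι : X → Y} (hι : IsTropicalModification ι) {Ψ : Y → TP n}
    {Q : Multiset (Y × Finset (Fin (n + 1)))} (h : IsBalancedUpTo M Ψ Q) :
    ∃ (Z : Type u) (_ : MetricSpace Z) (κ : X → Z) (Ψ' : Z → TP n), IsTropicalModification κ ∧
      IsBalanced Ψ' ∧ (∀ z, Ψ' z ∈ tropicalLinearSpace M) ∧ ∀ x, Ψ' (κ x) = Ψ (ι x) := by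
  induction hN : (Q.map fun q => q.2.card).sum using Nat.strong_induction_on generalizing Y with
  | _ N ih =>
    rcases Q.empty_or_exists_mem with rfl | ⟨⟨p, P⟩, hq⟩
    · exact ⟨Y, _, ι, Ψ, hι, h.isBalanced, h.mem, fun _ => rfl⟩
    · obtain ⟨Q, rfl⟩ := Multiset.exists_cons_of_mem hq
      obtain ⟨Ψ', Q', h1, h2, h3⟩ := h.exists_attachedRay hM
      obtain ⟨Z, hZ, κ, Ψ'', g1, g2, g3, g4⟩ := ih _ (hN ▸ h3)
        (IsTropicalModification.step ι _ hι AttachedRay.isElementaryModification) h2 rfl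
      exact ⟨Z, hZ, κ, Ψ'', g1, g2, g3, fun x => (g4 x).trans (h1 _)⟩

end Extension

/-! ### Finiteness of the divisor of a piecewise linear function. -/

section PiecewiseLinear

variable {X : Type u} [MetricSpace X]

theorem IsMetricGraph.exists_isStar (hX : IsMetricGraph X) (v : X) :
    ∃ (k : ℕ) (ε : ℝ) (arm : Fin k → ℝ → X), IsStar v ε arm := by
  obtain ⟨k, ε, arm, h1, h2, h3, h4, h5⟩ := hX.star v
  exact ⟨k, ε, arm, h1, h2, h3, h4, h5⟩

theorem IsStar.tendsto_arm {J : Type*} {v : X} {ε : ℝ} {arm : J → ℝ → X} (h : IsStar v ε arm)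
    (j : J) : Tendsto (arm j) (𝓝[≥] 0) (𝓝 v) := by
  rw [Metric.tendsto_nhds]
  intro δ hδ
  filter_upwards [eventually_lt_nhdsGE_zero h.pos, eventually_lt_nhdsGE_zero hδ] with t h1 h2
  rw [h.dist_center j h1]
  exact h2.2

theorem IsStar.exists_slopes {J : Type*} {v : X} {ε : ℝ} {arm : J → ℝ → X} (h : IsStar v ε arm)
    {f : X → ℝ} (hf : f ∈ PL X) :
    ∃ z : J → ℤ, ∀ j, ∀ᶠ t in 𝓝[≥] (0 : ℝ), f (arm j t) = f v + t • (z j : ℝ) := by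
  choose z hz using fun j => hf.2 v (Quotient.mk _ (h.segment j))
  exact ⟨z, fun j => h.eventually_of_hasSlope (hz j)⟩

theorem IsStar.ord_eq {J : Type*} [Fintype J] {v : X} {ε : ℝ} {arm : J → ℝ → X}
    (h : IsStar v ε arm) {f : X → ℝ} {s : J → ℝ}
    (hs : ∀ j, ∀ᶠ t in 𝓝[≥] (0 : ℝ), f (arm j t) = f v + t • s j) :
    ord f v = -∑ j, s j := by
  rw [ord, h.finsum_outSlope hs]

/-- On a small enough star `f` is affine along each arm, and a point inside an arm has just two
tangent vectors, with opposite slopes. -/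
theorem IsMetricGraph.exists_nhds_ord_eq_zero (hX : IsMetricGraph X) {f : X → ℝ}
    (hf : f ∈ PL X) (v : X) : ∃ U ∈ 𝓝 v, ∀ w ∈ U, w ≠ v → ord f w = 0 := by
  obtain ⟨k, ε, arm, h⟩ := hX.exists_isStar v
  obtain ⟨z, hz⟩ := h.exists_slopes hf
  obtain ⟨η, hη, hη'⟩ := mem_nhdsGE_iff_exists_Ico_subset.1 (eventually_all.2 hz)
  have hη0 : (0 : ℝ) < η := hη
  refine ⟨Metric.ball v (min η ε), Metric.ball_mem_nhds v (lt_min hη0 h.pos), fun w hw hwv => ?_⟩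
  rw [Metric.mem_ball] at hw
  obtain ⟨hwη, hwε⟩ := lt_min_iff.1 hw
  obtain ⟨j, s, hs, rfl⟩ := (h.cover w hwε).resolve_left hwv
  rw [h.dist_center j hs] at hwη
  have hs0 : 0 < s := lt_of_le_of_ne hs.1 fun h' => hwv (by rw [← h', h.zero])
  -- This radius keeps the segment around `w` away from `v` and within the range where `f` is
  -- affine.
  have hδ : 0 < min s (min η ε - s) := lt_min hs0 (sub_pos.2 (lt_min hwη hs.2))
  set δ := min s (min η ε - s) with hδdef
  have hδs : δ ≤ s := min_le_left _ _
  have hδε : δ ≤ min η ε - s := min_le_right _ _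
  have hminη := min_le_left η ε
  have hminε := min_le_right η ε
  have hline := isStar_of_line (fun u => arm j (s + u)) hδ (fun a ha b hb => by
      have := ha.1; have := ha.2; have := hb.1; have := hb.2
      rw [h.isometry j _ ⟨by linarith, by linarith⟩ _ ⟨by linarith, by linarith⟩]
      congr 1; ring) (fun y hy => by
      simp only [add_zero] at hy
      have hyv : dist y v < s + δ := by
        have := dist_triangle y (arm j s) v
        rw [h.dist_center j hs] at this
        linarith
      rcases h.cover y (by linarith) with rfl | ⟨i, t, ht, rfl⟩
      · rw [dist_comm, h.dist_center j hs] at hy; linarith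
      · by_cases hij : i = j
        · subst hij
          rw [h.isometry i t ht s hs, abs_lt] at hy
          exact ⟨t - s, hy, by simp⟩
        · rw [h.cross i j hij t ht s hs] at hy
          linarith [ht.1])
  simp only [add_zero] at hline
  have hfj : ∀ t, 0 ≤ t → t < η → f (arm j t) = f v + t • (z j : ℝ) := fun t h1 h2 =>
    hη' ⟨h1, h2⟩ j
  rw [hline.ord_eq (s := fun b => if b then (z j : ℝ) else -z j)]
  · simp
  · intro b
    filter_upwards [eventually_lt_nhdsGE_zero hδ] with t ht
    have := ht.1; have := ht.2
    cases b
    · simp only [Bool.false_eq_true, if_false]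
      rw [hfj _ (by linarith) (by linarith), hfj s hs0.le hwη]
      simp only [smul_eq_mul]; ring
    · simp only [if_true]
      rw [hfj _ (by linarith) (by linarith), hfj s hs0.le hwη]
      simp only [smul_eq_mul]; ring

theorem IsMetricGraph.finite_ord_ne_zero (hX : IsMetricGraph X) {f : X → ℝ} (hf : f ∈ PL X) :
    {v | ord f v ≠ 0}.Finite := by
  have := hX.compact
  choose U hU hU' using hX.exists_nhds_ord_eq_zero hf
  obtain ⟨t, -, ht⟩ := isCompact_univ.elim_nhds_subcover U fun x _ => hU x
  refine t.finite_toSet.subset fun v hv => ?_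
  obtain ⟨x, hx, hvx⟩ := mem_iUnion₂.1 (ht (mem_univ v))
  by_cases h : v = x
  · exact h ▸ hx
  · exact absurd (hU' x v hvx h) hv

end PiecewiseLinear

/-! ### From dependences to a map that is balanced up to parallel classes. -/

section Dependence

theorem isTropicalZero_shift_of_isDependence {X : Type u} {I : Type*}
    {M : Set (I → WithTop ℝ)} {φ : I → X → ℝ}
    (hM : ∀ V ∈ M, IsDependence φ V) (v : X) : IsTropicalZero (shift M fun i => φ i v) := by
  rintro _ ⟨V, hV, rfl⟩
  simpa only [add_comm] using hM V hV v

variable {X : Type u} [MetricSpace X] {I : Type*} [Finite I]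

/-- Functions that are parallel in the initial matroid at `v` differ by a constant near `v`. -/
theorem eventually_sub_eq_of_parallel {M : Set (I → WithTop ℝ)} {φ : I → X → ℝ}
    (hφ : ∀ i, Continuous (φ i)) (hM : ∀ V ∈ M, IsDependence φ V) {v : X} {i j : I}
    (h : Parallel (shift M fun i => φ i v) i j) :
    ∀ᶠ y in 𝓝 v, φ i y - φ i v = φ j y - φ j v := by
  rcases h with rfl | ⟨_, ⟨V, hV, rfl⟩, h1, h2, h3⟩
  · exact Eventually.of_forall fun _ => rfl
  simp only [← WithTop.coe_zero, add_coe_eq_coe] at h1 h2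
  -- By continuity the other terms stay above those of `i` and `j` near `v`, so these two must share
  -- the minimum.
  have hev : ∀ l : I, ∀ᶠ y in 𝓝 v, ∀ k, k ≠ i → k ≠ j →
      ((φ l y - φ l v : ℝ) : WithTop ℝ) < φ k y + V k := by
    intro l
    rw [eventually_all]
    intro k
    by_cases hki : k = i
    · simp [hki]
    by_cases hkj : k = j
    · simp [hkj]
    by_cases hVk : V k = ⊤
    · refine Eventually.of_forall fun y _ _ => ?_
      rw [hVk, WithTop.add_top]
      exact WithTop.coe_lt_top _
    obtain ⟨a, ha⟩ := WithTop.ne_top_iff_exists.1 hVk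
    have h := h3 k hki hkj
    simp only [← ha] at h ⊢
    norm_cast at h ⊢
    have hc : Continuous fun y => φ k y + a - (φ l y - φ l v) := by
      have := hφ k; have := hφ l; fun_prop
    have : ∀ᶠ y in 𝓝 v, 0 < φ k y + a - (φ l y - φ l v) :=
      hc.continuousAt.eventually (lt_mem_nhds (by simpa [add_comm] using h))
    filter_upwards [this] with y hy _ _
    linarith
  have hval : ∀ y, (φ i y : WithTop ℝ) + V i = ((φ i y - φ i v : ℝ) : WithTop ℝ) := fun y => by
    rw [h1]; norm_cast; ring
  have hval' : ∀ y, (φ j y : WithTop ℝ) + V j = ((φ j y - φ j v : ℝ) : WithTop ℝ) := fun y => by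
    rw [h2]; norm_cast; ring
  filter_upwards [hev i, hev j] with y hi hj
  refine le_antisymm ?_ ?_
  · obtain ⟨k, hk, hle⟩ := (hM V hV y).exists_le j
    rw [hval'] at hle
    by_cases hki : k = i
    · rw [hki, hval] at hle; exact_mod_cast hle
    · exact absurd (hj k hki hk) (not_lt.2 hle)
  · obtain ⟨k, hk, hle⟩ := (hM V hV y).exists_le i
    rw [hval] at hle
    by_cases hkj : k = j
    · rw [hkj, hval'] at hle; exact_mod_cast hle
    · exact absurd (hi k hk hkj) (not_lt.2 hle)

/-- The map defined by functions in `R(D)` is balanced up to finitely many classes of parallel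
elements. -/
theorem IsMetricGraph.exists_isBalancedUpTo (hX : IsMetricGraph X) {D : X →₀ ℤ} {n r : ℕ}
    {φ : Fin (n + 1) → X → ℝ} (hφ : ∀ i, φ i ∈ R D) {M : Set (Fin (n + 1) → WithTop ℝ)}
    (hM : IsValuatedMatroid M r) (hdep : ∀ V ∈ M, IsDependence φ V) :
    ∃ Q, IsBalancedUpTo M (fun x => TP.mk fun i => φ i x) Q := by
  classical
  have hcont : ∀ i, Continuous (φ i) := fun i => (hφ i).1.1
  have h0 := isTropicalZero_shift_of_isDependence hdep
  choose k ε arm hstar using hX.exists_isStar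
  choose z hz using fun v i => (hstar v).exists_slopes (hφ i).1
  have hord : ∀ v i, ord (φ i) v = -∑ j, (z v i j : ℝ) := fun v i => (hstar v).ord_eq (hz v i)
  have hnonneg : ∀ v i, 0 ≤ D v - ∑ j, z v i j := by
    intro v i
    have := (hφ i).2 v
    rw [hord] at this
    have : ((0 : ℤ) : ℝ) ≤ ((D v - ∑ j, z v i j : ℤ) : ℝ) := by push_cast; linarith
    exact_mod_cast this
  -- The coefficient of `D + div φ_i` at `v`, nonnegative because `φ_i ∈ R(D)`.
  let E : X → Fin (n + 1) → ℕ := fun v i => (D v - ∑ j, z v i j).toNat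
  have hE : ∀ v i, (E v i : ℝ) = D v - ∑ j, (z v i j : ℝ) := by
    intro v i
    have : ((E v i : ℤ) : ℝ) = ((D v - ∑ j, z v i j : ℤ) : ℝ) := by
      rw [Int.toNat_of_nonneg (hnonneg v i)]
    push_cast at this
    exact this
  have hpar : ∀ v i j, Parallel (shift M fun i => φ i v) i j → E v i = E v j := by
    intro v i j hij
    have : ∀ a, z v i a = z v j a := by
      intro a
      have : (z v i a : ℝ) = z v j a := by
        refine eq_of_eventually_smul_eq ?_
        filter_upwards [hz v i a, hz v j a, ((hstar v).tendsto_arm a).eventually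
          (eventually_sub_eq_of_parallel hcont hdep hij)] with t h1 h2 h3
        linarith
      exact_mod_cast this
    simp only [E, this]
  choose K hK1 hK2 _ using fun v =>
    exists_multiset_parallelClass (hM.shift fun i => φ i v) (h0 v) (E v) (hpar v)
  have hfin : {v | D v ≠ 0 ∨ ∃ i, ord (φ i) v ≠ 0}.Finite := by
    have : {v | D v ≠ 0 ∨ ∃ i, ord (φ i) v ≠ 0} = ↑D.support ∪ ⋃ i, {v | ord (φ i) v ≠ 0} := by
      ext v; simp
    rw [this]
    exact D.support.finite_toSet.union (finite_iUnion fun i => hX.finite_ord_ne_zero (hφ i).1)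
  set F := hfin.toFinset with hF
  have hEF : ∀ v, v ∉ F → E v = 0 := by
    intro v hv
    rw [hF, Finite.mem_toFinset] at hv
    simp only [mem_ofPred_eq, not_or, not_exists, not_not] at hv
    ext i
    have h1 := hE v i
    have h2 := hord v i
    rw [hv.2 i] at h2
    rw [hv.1] at h1
    have : (E v i : ℝ) = 0 := by rw [h1]; push_cast; linarith
    exact_mod_cast this
  let Q : Multiset (X × Finset (Fin (n + 1))) := ∑ v ∈ F, (K v).map fun P => (v, P)
  have hQ : ∀ v, weight Q v = fun i => (E v i : ℝ) := by
    intro v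
    have h1 : weight Q v = ∑ u ∈ F, weight ((K u).map fun P => (u, P)) v :=
      map_sum (AddMonoidHom.mk' (fun Q => weight Q v) fun Q Q' => weight_add Q Q' v) _ _
    have h2 : ∀ u, u ≠ v → weight ((K u).map fun P => (u, P)) v = 0 := by
      intro u hu
      refine weight_eq_zero fun q hq => ?_
      obtain ⟨P, -, rfl⟩ := Multiset.mem_map.1 hq
      exact hu
    rw [h1]
    by_cases hv : v ∈ F
    · rw [Finset.sum_eq_single_of_mem v hv fun u _ hu => h2 u hu, weight_map_mk_self, hK2]
    · rw [Finset.sum_eq_zero fun u hu => h2 u fun h => hv (h ▸ hu), hEF v hv]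
      ext; simp
  refine ⟨Q, TP.continuous_mk.comp (continuous_pi hcont), fun v =>
    mem_tropicalLinearSpace.2 ⟨_, rfl, h0 v⟩, fun q hq => ?_, fun v => ?_⟩
  · obtain ⟨v, -, hv⟩ := Multiset.mem_sum.1 hq
    obtain ⟨P, hP, rfl⟩ := Multiset.mem_map.1 hv
    exact ⟨_, rfl, h0 v, hK1 v P hP⟩
  · refine ⟨Fin (k v), inferInstance, ε v, arm v, fun j i => z v i j, hstar v,
      fun j => ⟨fun i => z v i j, rfl⟩, fun j => ?_, ?_⟩
    · filter_upwards [eventually_all.2 fun i => hz v i j] with t ht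
      rw [← TP.mk_smul, ← TP.mk_add]
      congr 1
      ext i
      exact ht i
    -- The slopes and `E v` add up to `D v` in every coordinate, which is zero in `TP n`.
    · rw [hQ, ← TP.mk_const (n := n) (D v : ℝ)]
      congr 1
      ext i
      rw [Pi.add_apply, Finset.sum_apply, hE]
      ring

end Dependence

/-! ### Restricting the valuated matroid to the generators. -/

section Restriction

variable {X : Type u} {S : Set (X → ℝ)} {C : Set (S → WithTop ℝ)} {E : Type*} {φ : E → S}

theorem exists_ne_top_of_mem_restrictCircuits {k : ℕ} (hC : IsValuatedMatroid C k)
    {W : E → WithTop ℝ} (hW : W ∈ restrictCircuits C φ) : ∃ e, W e ≠ ⊤ := by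
  obtain ⟨V, hV, hs, rfl⟩ := hW
  by_contra! h
  refine hC.infty_notMem ?_
  convert hV
  rename_i f
  by_contra hf
  obtain ⟨e, rfl⟩ := hs (Ne.symm hf)
  exact hf (h e).symm

/-- The restriction of a valuated matroid to a finite family is a valuated matroid. -/
theorem exists_isValuatedMatroid_restrictCircuits [Finite E] {k : ℕ}
    (hC : IsValuatedMatroid C k) : ∃ l, IsValuatedMatroid (restrictCircuits C φ) l := by
  have hne : {l : ℕ | ∃ A : Set E, IsIndependent (restrictCircuits C φ) A ∧ A.encard = l}.Nonempty :=
    ⟨0, ∅, fun W hW hs => by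
      obtain ⟨e, he⟩ := exists_ne_top_of_mem_restrictCircuits hC hW
      exact hs he, by simp⟩
  have hbdd : BddAbove
      {l : ℕ | ∃ A : Set E, IsIndependent (restrictCircuits C φ) A ∧ A.encard = l} := by
    refine ⟨(univ : Set E).ncard, ?_⟩
    rintro l ⟨A, -, hA⟩
    have : A.ncard = l := by rw [ncard, hA]; rfl
    rw [← this]
    exact ncard_le_ncard (subset_univ A) finite_univ
  -- The rank is taken to be the largest size of an independent set, which exists because `E` is
  -- finite.
  refine ⟨sSup {l : ℕ | ∃ A : Set E, IsIndependent (restrictCircuits C φ) A ∧ A.encard = l},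
    fun h => ?_, ?_, ?_, Nat.sSup_mem hne hbdd, fun A hA => ?_, ?_⟩
  · obtain ⟨e, he⟩ := exists_ne_top_of_mem_restrictCircuits hC h
    exact he rfl
  · rintro _ ⟨V, hV, hs, rfl⟩ a
    refine ⟨_, hC.add_const V hV a, ?_, rfl⟩
    rwa [supp_add_coe V fun _ => a]
  · rintro _ ⟨V, hV, hs, rfl⟩ _ ⟨W, hW, hs', rfl⟩ hne' hsub
    refine hC.incomparable V hV W hW (fun h => hne' ?_) fun f hf => ?_
    · ext e
      exact (Set.ext_iff.1 h (φ e) :)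
    · obtain ⟨e, rfl⟩ := hs hf
      exact hsub hf
  · have hfin := A.toFinite
    rw [← hfin.cast_ncard_eq]
    exact Nat.cast_le.2 (le_csSup hbdd ⟨A, hA, hfin.cast_ncard_eq.symm⟩)
  · rintro _ ⟨V, hV, hs, rfl⟩ _ ⟨W, hW, hs', rfl⟩ e e' he hne' hlt
    obtain ⟨U, hU, h1, h2, h3⟩ := hC.elimination V hV W hW (φ e) (φ e') he hne' hlt
    refine ⟨_, ⟨U, hU, fun f hf => ?_, rfl⟩, h1, h2, fun x => h3 (φ x)⟩
    by_contra hf'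
    have hVf : V f = ⊤ := by_contra fun h => hf' (hs h)
    have hWf : W f = ⊤ := by_contra fun h => hf' (hs' h)
    have := h3 f
    rw [hVf, hWf, min_self, top_le_iff] at this
    exact hf this

/-- The circuit is finite at some generator, so the minimum over all of `S` is finite and both
minimisers lie in the support, hence among the generators. -/
theorem isDependence_of_mem_restrictCircuits {k : ℕ} (hC : IsValuatedMatroid C k)
    (hdep : ∀ V ∈ C, IsDependence (fun f : S => f.1) V) {W : E → WithTop ℝ}
    (hW : W ∈ restrictCircuits C φ) : IsDependence (fun e => (φ e : X → ℝ)) W := by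
  obtain ⟨e, he⟩ := exists_ne_top_of_mem_restrictCircuits hC hW
  obtain ⟨V, hV, hs, rfl⟩ := hW
  intro x
  obtain ⟨f, g, hfg, heq, hmin⟩ := hdep V hV x
  have hlt : (f.1 x : WithTop ℝ) + V f < ⊤ := (hmin (φ e)).trans_lt (by
    exact lt_top_iff_ne_top.2 fun h => he ((add_coe_eq_top _ _).1 ((add_comm _ _).trans h)))
  have hmem : ∀ f : S, (f.1 x : WithTop ℝ) + V f < ⊤ → f ∈ range φ := fun f hf =>
    hs fun h => hf.ne (by rw [h, WithTop.add_top])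
  obtain ⟨i, rfl⟩ := hmem f hlt
  obtain ⟨j, rfl⟩ := hmem g (heq.symm.trans_lt hlt)
  exact ⟨i, j, fun h => hfg (h ▸ rfl), heq, fun k => hmin (φ k)⟩

end Restriction

theorem IsTropicalLinearSeries.subset {X : Type u} [MetricSpace X] {D : X →₀ ℤ} {r : ℕ}
    {S : Set (X → ℝ)} (h : IsTropicalLinearSeries D r S) : S ⊆ R D := by
  rw [IsTropicalLinearSeries] at h
  exact h.1

end TropicalSeries

theorem mainTheorem7 {X : Type u} [MetricSpace X] (hX : IsMetricGraph X) (D : X →₀ ℤ)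
    (r n : ℕ) (S : Set (X → ℝ)) (hS : IsStrongTropicalLinearSeries D r S)
    (φ : Fin (n + 1) → S) (hφ : tropicalSpan (range fun i => (φ i : X → ℝ)) = S) :
    (∀ C : Set (S → WithTop ℝ), IsDependenceMatroid r S C →
      (∃ k, IsValuatedMatroid (restrictCircuits C φ) k) ∧
      ∀ V ∈ restrictCircuits C φ, IsDependence (fun i => (φ i : X → ℝ)) V) ∧
    ∀ (M : Set (Fin (n + 1) → WithTop ℝ)) (k : ℕ), IsValuatedMatroid M k →
      (∀ V ∈ M, IsDependence (fun i => (φ i : X → ℝ)) V) →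
      (∀ x, TP.mk (fun i => (φ i : X → ℝ) x) ∈ tropicalLinearSpace M) ∧
      ∃ (Y : Type u) (_ : MetricSpace Y) (ι : X → Y) (Ψ : Y → TP n),
        IsTropicalModification ι ∧ IsBalanced Ψ ∧ (∀ y, Ψ y ∈ tropicalLinearSpace M) ∧
        ∀ x, Ψ (ι x) = TP.mk (fun i => (φ i : X → ℝ) x) := by
  refine ⟨fun C hC => ⟨exists_isValuatedMatroid_restrictCircuits hC.1, fun V hV =>
    isDependence_of_mem_restrictCircuits hC.1 hC.2 hV⟩, fun M k hM hdep => ?_⟩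
  obtain ⟨Q, hQ⟩ := hX.exists_isBalancedUpTo (fun i => hS.series.subset (φ i).2) hM hdep
  exact ⟨hQ.mem, exists_isTropicalModification_isBalanced hM .refl hQ⟩
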